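/- Let $X\subseteq\mathbb R^d$ be compact, let $\rho$ be a Borel probability measure on $X$, and let $\Phi=\{\phi_i\}_{i=1}^n\subset L^2_\rho(X)$ be complex-valued, piecewise Lipschitz functions, where a function is piecewise Lipschitz if $X$ splits into finitely many measurable pieces on each of which the function is Lipschitz. Write $\phi(x)=(\phi_1(x),\dots,\phi_n(x))^\top$ and $G_{ij}=\int_X\phi_i\overline{\phi_j}\,d\rho$. Let $\epsilon>0$ and, for a positive semidefinite matrix $M$, put $$k^\epsilon(x;\Phi,M)=\phi(x)^*(M+\epsilon^2I)^{-1}\phi(x),\qquad k^\epsilon(x;\Phi)=k^\epsilon(x;\Phi,G),\qquad n^\epsilon(\Phi)=\sum_{i=1}^n\frac{\lambda_i(G)}{\lambda_i(G)+\epsilon^2}.$$ Assume that $\inf_{x\in X}k^\epsilon(x;\Phi)>0$ and $\|G\|_2\ge\epsilon^2$ (spectral norm). Let $u:X\to\mathbb R$ be integrable and piecewise Lipschitz with $u(x)\ge k^\epsilon(x;\Phi)$ for all $x\in X$, put $w_u=\|u\|_{L^1_\rho(X)}/u$, and let $\mu_u$ be the probability measure with $w_u\,d\mu_u=d\rho$.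 Let $\alpha>0$, $0<\Delta<1$, $0<\gamma<1$, and let $m\in\mathbb N$ satisfy $$m\ge c_\Delta\log\big(16\,n^\epsilon(\Phi)/\gamma\big)\int_Xu\,d\rho,\qquad c_\Delta=\frac{1+2\Delta/3}{\Delta^2/2},\qquad \lceil\alpha m+1\rceil<m .$$ Draw i.i.d. samples $x_1,\dots,x_{\lceil\alpha m+1\rceil}$ from $\mu_u$, let $A$ be the $\lceil\alpha m+1\rceil\times n$ matrix with entries $A_{kj}=\sqrt{w_u(x_k)/m}\;\overline{\phi_j(x_k)}$, and define $$u^{(new)}(x)=\min\big(u(x),\,(1+\Delta)\,\phi(x)^*(A^*A+\epsilon^2I)^{-1}\phi(x)\big).$$ Then, with probability at least $1-2\gamma$, both $$u^{(new)}(x)\ge k^\epsilon(x;\Phi)\quad\text{for all }x\in X\qquad\text{and}\qquad \int_Xu^{(new)}\,d\rho\le\frac{2}{1-\Delta}\,\frac{n^\epsilon(\Phi)}{\alpha}$$ hold, where $u^{(new)}$ is $\rho$-integrable. -/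

import Mathlib

open MeasureTheory ProbabilityTheory
open scoped NNReal ENNReal Matrix

noncomputable section

namespace Christoffel

/-- `f` is piecewise Lipschitz continuous: its domain splits into finitely many measurable pieces
on each of which `f` is Lipschitz. -/
def PiecewiseLipschitz {S E : Type*} [PseudoEMetricSpace S] [MeasurableSpace S]
    [PseudoEMetricSpace E] (f : S → E) : Prop :=
  ∃ (N : ℕ) (piece : Fin N → Set S),
    (∀ i, MeasurableSet (piece i)) ∧
    (∀ i j, i ≠ j → Disjoint (piece i) (piece j)) ∧
    (⋃ i, piece i) = Set.univ ∧
    ∀ i, ∃ K : ℝ≥0, LipschitzOnWith K f (piece i)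

section

variable {S : Type*} [MeasurableSpace S] {n : ℕ}

/-- The Gram matrix `G i j = ⟨φ_i, φ_j⟩ = ∫ φ_i conj(φ_j) dρ`. -/
def gram (ρ : Measure S) (φ : Fin n → S → ℂ) : Matrix (Fin n) (Fin n) ℂ :=
  Matrix.of fun i j => ∫ x, φ i x * star (φ j x) ∂ρ

theorem gram_isHermitian (ρ : Measure S) (φ : Fin n → S → ℂ) : (gram ρ φ).IsHermitian := by
  ext i j
  simp only [gram, Matrix.conjTranspose_apply, Matrix.of_apply]
  have h := integral_conj (μ := ρ) (f := fun x => φ j x * star (φ i x))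
  simp only [starRingEnd_apply] at h
  rw [← h]
  congr 1
  funext x
  simp [mul_comm]

/-- `k^ε(x; Φ, M) = φ(x)^* (M + ε² I)⁻¹ φ(x)`. The number is real for Hermitian `M`. -/
def kWith (φ : Fin n → S → ℂ) (ε : ℝ) (M : Matrix (Fin n) (Fin n) ℂ) (x : S) : ℝ :=
  (star (fun i => φ i x) ⬝ᵥ
    ((M + ((ε : ℂ) ^ 2) • (1 : Matrix (Fin n) (Fin n) ℂ))⁻¹ *ᵥ fun i => φ i x)).re

/-- The numerical inverse Christoffel function `k^ε(x; Φ) = φ(x)^* (G + ε² I)⁻¹ φ(x)`. -/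
def kFun (ρ : Measure S) (φ : Fin n → S → ℂ) (ε : ℝ) (x : S) : ℝ :=
  kWith φ ε (gram ρ φ) x

/-- The numerical dimension `n^ε(Φ) = ∑ i, λ_i(G) / (λ_i(G) + ε²)`. -/
def numDim (ρ : Measure S) (φ : Fin n → S → ℂ) (ε : ℝ) : ℝ :=
  ∑ i, (gram_isHermitian ρ φ).eigenvalues i / ((gram_isHermitian ρ φ).eigenvalues i + ε ^ 2)

/-- The weight `w_u = ‖u‖_{L¹(ρ)} / u`. -/
def weight (ρ : Measure S) (u : S → ℝ) (x : S) : ℝ :=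
  (∫ y, |u y| ∂ρ) / u x

/-- The sampling measure `μ_u`, given by `w_u dμ_u = dρ`, that is `dμ_u = (u / ‖u‖_{L¹(ρ)}) dρ`
for positive `u`. -/
def samplingMeasure (ρ : Measure S) (u : S → ℝ) : Measure S :=
  ρ.withDensity fun x => ENNReal.ofReal (u x / ∫ y, |u y| ∂ρ)

/-- The matrix `A k j = √(w_u(x_k) / m) conj(φ_j(x_k))` of the `M` samples `x`, with the
normalization `m`. -/
def sampleMatrix (ρ : Measure S) (φ : Fin n → S → ℂ) (u : S → ℝ) (m : ℕ) {M : ℕ}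
    (x : Fin M → S) : Matrix (Fin M) (Fin n) ℂ :=
  Matrix.of fun k j => ((√(weight ρ u (x k) / m) : ℝ) : ℂ) * star (φ j (x k))

/-- The updated function
`u_new(y) = min (u(y)) ((1 + Δ) φ(y)^* (A^* A + ε² I)⁻¹ φ(y))`. -/
def uNew (ρ : Measure S) (φ : Fin n → S → ℂ) (ε : ℝ) (u : S → ℝ) (Δ : ℝ) (m : ℕ) {M : ℕ}
    (x : Fin M → S) (y : S) : ℝ :=
  min (u y)
    ((1 + Δ) * kWith φ ε ((sampleMatrix ρ φ u m x)ᴴ * sampleMatrix ρ φ u m x) y)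

end

end Christoffel

end

/-! Write `H = G + ε² I`. Both guarantees follow from order relations between `A^* A` and Gram
matrices, because `K ↦ φ^* K⁻¹ φ` reverses the Loewner order. If `A^* A ≤ G + Δ H`, then `A^* A + ε²
I ≤ (1 + Δ) H`, and the first guarantee follows (`kFun_le_mul_kWith`).

For the integral, about `α m` samples are too few to bound `A^* A` below by a multiple of `G`. The
Gram matrix is therefore replaced by `G_s = ∫ s φ φ^* dρ` with `0 ≤ s ≤ 1` and `s = min (1, α u /
k_s)`, where `k_s = φ^* (G_s + ε² I)⁻¹ φ`. Such an `s` is the limit of a decreasing iteration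
(`exists_reweight_fixedPoint`). Since `s k_s ≤ α u`, the coherence drops by the factor `α`, and the
available samples give `A^* A ≥ α (G_s - Δ (G_s + ε² I))`. Where `s = 1`, the second term of the
minimum in `uNew` is at most `C s k_s` with `C = (1 + Δ) / ((1 - Δ) α)`; elsewhere `u = α⁻¹ s k_s ≤
C s k_s`. Finally `∫ s k_s dρ = tr (G_s (G_s + ε² I)⁻¹)`, which is at most the numerical dimension
since `G_s ≤ G` (`integral_uNew_le`).

Both matrix bounds come from a Bernstein inequality whose prefactor is the trace of the whitened
mean instead of the size of the matrix (`measureReal_not_sum_le_le`). It rests on the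
Golden–Thompson inequality, applied one summand at a time, and on Markov's inequality for `tr (exp A
- 1 - A)`. Each bound fails with probability at most `γ`. -/

namespace Christoffel

open scoped Matrix.Norms.L2Operator MatrixOrder ComplexOrder
open Filter Topology

set_option linter.unusedSectionVars false

/-! ### Trace inequalities for powers of products. -/

section TraceInequalities

variable {ι : Type*} [Fintype ι] [DecidableEq ι]

theorem trace_mul_pow_comm (A B : Matrix ι ι ℂ) (q : ℕ) :
    ((A * B) ^ q).trace = ((B * A) ^ q).trace := by
  cases q with
  | zero => simp
  | succ q =>
    rw [pow_succ (A * B), ← mul_assoc, mul_pow_mul, mul_assoc, Matrix.trace_mul_comm,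
      mul_assoc, ← pow_succ]

theorem trace_mul_conjTranspose_re {ι : Type*} [Fintype ι] (A : Matrix ι ι ℂ) :
    (A * Aᴴ).trace.re = ∑ i, ∑ j, ‖A i j‖ ^ 2 := by
  simp only [Matrix.trace, Matrix.diag_apply, Matrix.mul_apply, Matrix.conjTranspose_apply,
    Complex.re_sum]
  refine Finset.sum_congr rfl fun i _ => Finset.sum_congr rfl fun j _ => ?_
  rw [← Complex.normSq_eq_norm_sq, ← Complex.ofReal_re (Complex.normSq _), Complex.star_def,
    Complex.mul_conj]

/-- The Cauchy–Schwarz inequality for the trace, in additive form. -/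
theorem norm_trace_mul_le {ι : Type*} [Fintype ι] (A B : Matrix ι ι ℂ) :
    ‖(A * B).trace‖ ≤ ((A * Aᴴ).trace.re + (B * Bᴴ).trace.re) / 2 := by
  rw [trace_mul_conjTranspose_re, trace_mul_conjTranspose_re]
  have h1 : ‖(A * B).trace‖ ≤ ∑ i, ∑ j, ‖A i j‖ * ‖B j i‖ := by
    simp only [Matrix.trace, Matrix.diag_apply, Matrix.mul_apply]
    refine (norm_sum_le _ _).trans (Finset.sum_le_sum fun i _ => ?_)
    refine (norm_sum_le _ _).trans (Finset.sum_le_sum fun j _ => ?_)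
    rw [norm_mul]
  rw [Finset.sum_comm (f := fun i j => ‖B i j‖ ^ 2)]
  refine h1.trans ?_
  rw [← Finset.sum_add_distrib, Finset.sum_div]
  refine Finset.sum_le_sum fun i _ => ?_
  rw [← Finset.sum_add_distrib, Finset.sum_div]
  refine Finset.sum_le_sum fun j _ => ?_
  nlinarith [sq_nonneg (‖A i j‖ - ‖B j i‖)]

/-- The two statements feed each other, so they are proved by one induction. The first at level `k`,
applied to `Z²`, gives after cyclic permutation the trace of `((Z^* Z) (Z Z^*)) ^ 2 ^ k`; the second
separates the factors and Cauchy–Schwarz recombines them. Conversely, the first with `Z = P Q` turns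
`P Q` into `P² Q²`, to which the second applies at the lower level. -/
theorem norm_trace_pow_le_and (k : ℕ) :
    (∀ Z : Matrix ι ι ℂ, ‖(Z ^ 2 ^ (k + 1)).trace‖ ≤ ((Z * Zᴴ) ^ 2 ^ k).trace.re) ∧
    ∀ P Q : Matrix ι ι ℂ, P.IsHermitian → Q.IsHermitian →
      ‖((P * Q) ^ 2 ^ k).trace‖ ≤ ‖(P ^ 2 ^ k * Q ^ 2 ^ k).trace‖ := by
  induction k with
  | zero =>
    refine ⟨fun Z => ?_, fun P Q _ _ => by simp⟩
    have := norm_trace_mul_le Z Z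
    simp only [zero_add, pow_one, pow_zero, sq]
    linarith
  | succ k ih =>
    obtain ⟨hS, hG⟩ := ih
    refine ⟨fun Z => ?_, fun P Q hP hQ => ?_⟩
    · have hsum := norm_trace_mul_le ((Zᴴ * Z) ^ 2 ^ k) ((Z * Zᴴ) ^ 2 ^ k)
      have hL : ((Zᴴ * Z) ^ 2 ^ k).IsHermitian :=
        (Matrix.isHermitian_conjTranspose_mul_self Z).pow _
      have hR : ((Z * Zᴴ) ^ 2 ^ k).IsHermitian :=
        (Matrix.isHermitian_mul_conjTranspose_self Z).pow _
      rw [hL.eq, hR.eq, ← pow_add, ← pow_add, trace_mul_pow_comm Zᴴ Z, ← two_mul] at hsum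
      have h1 : ‖(Z ^ 2 ^ (k + 1 + 1)).trace‖ ≤ ((Z * Z * (Z * Z)ᴴ) ^ 2 ^ k).trace.re := by
        rw [pow_succ' 2 (k + 1), pow_mul, sq]
        exact hS (Z * Z)
      have h2 : ((Z * Z * (Z * Z)ᴴ) ^ 2 ^ k).trace = ((Zᴴ * Z * (Z * Zᴴ)) ^ 2 ^ k).trace := by
        rw [Matrix.conjTranspose_mul, show Z * Z * (Zᴴ * Zᴴ) = (Z * (Z * Zᴴ)) * Zᴴ by
          simp only [mul_assoc], trace_mul_pow_comm, ← mul_assoc]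
      rw [h2] at h1
      have h3 := hG (Zᴴ * Z) (Z * Zᴴ) (Matrix.isHermitian_conjTranspose_mul_self Z)
        (Matrix.isHermitian_mul_conjTranspose_self Z)
      have h4 := Complex.re_le_norm ((Zᴴ * Z * (Z * Zᴴ)) ^ 2 ^ k).trace
      rw [pow_succ' 2 k, two_mul]
      linarith
    · have h1 := hS (P * Q)
      have h2 : ((P * Q * (P * Q)ᴴ) ^ 2 ^ k).trace = ((P ^ 2 * Q ^ 2) ^ 2 ^ k).trace := by
        rw [Matrix.conjTranspose_mul, hP.eq, hQ.eq, show P * Q * (Q * P) = (P * (Q * Q)) * P by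
          simp only [mul_assoc], trace_mul_pow_comm, ← mul_assoc, sq, sq]
      rw [h2] at h1
      have h3 := hG (P ^ 2) (Q ^ 2) (hP.pow 2) (hQ.pow 2)
      rw [← pow_mul, ← pow_mul, ← pow_succ'] at h3
      exact (h1.trans (Complex.re_le_norm _)).trans h3

theorem norm_trace_mul_pow_two_pow_le {P Q : Matrix ι ι ℂ} (hP : P.IsHermitian)
    (hQ : Q.IsHermitian) (k : ℕ) :
    ‖((P * Q) ^ 2 ^ k).trace‖ ≤ ‖(P ^ 2 ^ k * Q ^ 2 ^ k).trace‖ :=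
  (norm_trace_pow_le_and k).2 P Q hP hQ

end TraceInequalities

/-! ### The Lie product formula. -/

section LieTrotter

variable {𝔸 : Type*} [NormedRing 𝔸] [NormOneClass 𝔸]

/-- Telescoping. The extra factor `M` on the left avoids the exponent `N - 1`. -/
theorem norm_pow_sub_pow_le {X Y : 𝔸} {M : ℝ} (hX : ‖X‖ ≤ M) (hY : ‖Y‖ ≤ M) (N : ℕ) :
    ‖X ^ N - Y ^ N‖ * M ≤ N * M ^ N * ‖X - Y‖ := by
  have hM : 0 ≤ M := (norm_nonneg _).trans hX
  induction N with
  | zero => simp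
  | succ N ih =>
    have h : X ^ (N + 1) - Y ^ (N + 1) = X ^ N * (X - Y) + (X ^ N - Y ^ N) * Y := by
      rw [pow_succ, pow_succ]; noncomm_ring
    have h1 : ‖X ^ N * (X - Y)‖ ≤ M ^ N * ‖X - Y‖ :=
      (norm_mul_le _ _).trans (mul_le_mul_of_nonneg_right
        ((norm_pow_le _ _).trans (pow_le_pow_left₀ (norm_nonneg _) hX N)) (norm_nonneg _))
    have h2 : ‖(X ^ N - Y ^ N) * Y‖ ≤ ‖X ^ N - Y ^ N‖ * M :=
      (norm_mul_le _ _).trans (mul_le_mul_of_nonneg_left hY (norm_nonneg _))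
    rw [h]
    calc ‖X ^ N * (X - Y) + (X ^ N - Y ^ N) * Y‖ * M
        ≤ (M ^ N * ‖X - Y‖ + N * M ^ N * ‖X - Y‖) * M :=
          mul_le_mul_of_nonneg_right ((norm_add_le _ _).trans (by linarith)) hM
      _ = ((N + 1 : ℕ) : ℝ) * M ^ (N + 1) * ‖X - Y‖ := by push_cast; ring

variable [NormedAlgebra ℝ 𝔸]

theorem norm_exp_le_exp_norm (x : 𝔸) : ‖NormedSpace.exp x‖ ≤ Real.exp ‖x‖ := by
  rw [NormedSpace.exp_eq_tsum ℝ, Real.exp_eq_exp_ℝ, NormedSpace.exp_eq_tsum ℝ]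
  refine tsum_of_norm_bounded (NormedSpace.expSeries_summable' (𝕂 := ℝ) ‖x‖).hasSum fun i => ?_
  rw [norm_smul, Real.norm_of_nonneg (by positivity), smul_eq_mul]
  exact mul_le_mul_of_nonneg_left (norm_pow_le _ _) (by positivity)

variable [CompleteSpace 𝔸]

/-- The **Lie product formula**. -/
theorem tendsto_exp_mul_exp_pow (A B : 𝔸) :
    Tendsto (fun N : ℕ => (NormedSpace.exp ((N : ℝ)⁻¹ • A) * NormedSpace.exp ((N : ℝ)⁻¹ • B)) ^ N)
      atTop (𝓝 (NormedSpace.exp (A + B))) := by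
  let _ : NormedAlgebra ℚ 𝔸 := NormedAlgebra.restrictScalars ℚ ℝ 𝔸
  -- The first-order terms cancel, so one step of size `1/N` has error `o(1/N)`. Passing to the
  -- `N`-th power costs only a factor `N * exp (‖A‖ + ‖B‖)`.
  have hd : HasDerivAt (fun t : ℝ => NormedSpace.exp (t • A) * NormedSpace.exp (t • B)
      - NormedSpace.exp (t • (A + B))) 0 0 := by
    have hA := hasDerivAt_exp_smul_const A (0 : ℝ)
    have hB := hasDerivAt_exp_smul_const B (0 : ℝ)
    have hAB := hasDerivAt_exp_smul_const (A + B) (0 : ℝ)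
    refine ((hA.mul hB).sub hAB).congr_deriv ?_
    simp
  rw [hasDerivAt_iff_tendsto_slope_zero] at hd
  have hinv : Tendsto (fun N : ℕ => ((N : ℝ))⁻¹) atTop (𝓝[≠] (0 : ℝ)) := by
    refine tendsto_nhdsWithin_iff.2 ⟨tendsto_inv_atTop_nhds_zero_nat, ?_⟩
    filter_upwards [eventually_gt_atTop 0] with N hN
    simpa using hN.ne'
  have hlim := (hd.comp hinv).norm
  rw [norm_zero] at hlim
  rw [tendsto_iff_norm_sub_tendsto_zero]
  have hlim2 := hlim.const_mul (Real.exp (‖A‖ + ‖B‖))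
  rw [mul_zero] at hlim2
  refine squeeze_zero' (Eventually.of_forall fun _ => norm_nonneg _) ?_ hlim2
  filter_upwards [eventually_gt_atTop 0] with N hN
  have hN' : (0 : ℝ) < N := by exact_mod_cast hN
  set M : ℝ := Real.exp ((N : ℝ)⁻¹ * (‖A‖ + ‖B‖)) with hMdef
  have hM1 : 1 ≤ M := Real.one_le_exp (by positivity)
  have hMN : M ^ N = Real.exp (‖A‖ + ‖B‖) := by
    rw [hMdef, ← Real.exp_nat_mul, ← mul_assoc, mul_inv_cancel₀ hN'.ne', one_mul]
  have hX : ‖NormedSpace.exp ((N : ℝ)⁻¹ • A) * NormedSpace.exp ((N : ℝ)⁻¹ • B)‖ ≤ M := by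
    refine (norm_mul_le _ _).trans ?_
    rw [hMdef, mul_add, Real.exp_add]
    refine mul_le_mul ?_ ?_ (norm_nonneg _) (Real.exp_pos _).le
    · refine (norm_exp_le_exp_norm _).trans_eq ?_
      rw [norm_smul, Real.norm_of_nonneg (by positivity)]
    · refine (norm_exp_le_exp_norm _).trans_eq ?_
      rw [norm_smul, Real.norm_of_nonneg (by positivity)]
  have hY : ‖NormedSpace.exp ((N : ℝ)⁻¹ • (A + B))‖ ≤ M := by
    refine (norm_exp_le_exp_norm _).trans (Real.exp_le_exp.2 ?_)
    rw [norm_smul, Real.norm_of_nonneg (by positivity)]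
    exact mul_le_mul_of_nonneg_left (norm_add_le _ _) (by positivity)
  have key := norm_pow_sub_pow_le hX hY N
  have hpow : NormedSpace.exp ((N : ℝ)⁻¹ • (A + B)) ^ N = NormedSpace.exp (A + B) := by
    rw [← NormedSpace.exp_nsmul, ← Nat.cast_smul_eq_nsmul ℝ, smul_smul, mul_inv_cancel₀ hN'.ne',
      one_smul]
  rw [hpow, hMN] at key
  have h3 := le_mul_of_one_le_right (norm_nonneg ((NormedSpace.exp ((N : ℝ)⁻¹ • A) *
    NormedSpace.exp ((N : ℝ)⁻¹ • B)) ^ N - NormedSpace.exp (A + B))) hM1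
  refine (h3.trans key).trans_eq ?_
  simp only [Function.comp_apply, zero_add, zero_smul, NormedSpace.exp_zero, mul_one, sub_self,
    sub_zero, inv_inv, norm_smul, Real.norm_of_nonneg hN'.le]
  ring

end LieTrotter

/-! ### The Golden–Thompson inequality. -/

section GoldenThompson

variable {ι : Type*} [Fintype ι] [DecidableEq ι]

/-- The **Golden–Thompson inequality**. -/
theorem norm_trace_exp_add_le {A B : Matrix ι ι ℂ} (hA : A.IsHermitian) (hB : B.IsHermitian) :
    ‖(NormedSpace.exp (A + B)).trace‖ ≤ ‖(NormedSpace.exp A * NormedSpace.exp B).trace‖ := by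
  rcases isEmpty_or_nonempty ι with h | h
  · simp [Matrix.trace]
  -- The trace inequality is available only for exponents `2 ^ k`, so the Lie formula is used along
  -- that subsequence.
  have h1 := (tendsto_exp_mul_exp_pow A B).comp (tendsto_pow_atTop_atTop_of_one_lt one_lt_two)
  have h2 : Continuous fun Z : Matrix ι ι ℂ => ‖Z.trace‖ :=
    (continuous_id.matrix_trace).norm
  refine le_of_tendsto' ((h2.tendsto _).comp h1) fun k => ?_
  have hsmul : ∀ {C : Matrix ι ι ℂ}, C.IsHermitian →
      (NormedSpace.exp ((((2 ^ k : ℕ) : ℝ))⁻¹ • C)).IsHermitian := fun {C} hC =>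
    Matrix.IsHermitian.exp (by
      rw [Matrix.IsHermitian, Matrix.conjTranspose_smul, hC.eq, star_trivial])
  have hpow : ∀ C : Matrix ι ι ℂ,
      NormedSpace.exp ((((2 ^ k : ℕ) : ℝ))⁻¹ • C) ^ 2 ^ k = NormedSpace.exp C := fun C => by
    rw [← Matrix.exp_nsmul, ← Nat.cast_smul_eq_nsmul ℝ, smul_smul, mul_inv_cancel₀ (by positivity),
      one_smul]
  have := norm_trace_mul_pow_two_pow_le (hsmul hA) (hsmul hB) k
  rwa [hpow, hpow] at this

end GoldenThompson

/-! ### Loewner order, traces and the matrix exponential. -/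

section FunctionalCalculus

variable {ι : Type*} [Fintype ι] [DecidableEq ι]

theorem re_trace_mul_nonneg {A B : Matrix ι ι ℂ} (hA : 0 ≤ A) (hB : 0 ≤ B) :
    0 ≤ (A * B).trace.re := by
  rw [Matrix.nonneg_iff_posSemidef] at hB
  obtain ⟨C, rfl⟩ := CStarAlgebra.nonneg_iff_eq_star_mul_self.1 hA
  have h := (hB.mul_mul_conjTranspose_same C).trace_nonneg
  rw [Matrix.star_eq_conjTranspose, mul_assoc, Matrix.trace_mul_comm]
  exact (Complex.le_def.1 h).1

theorem re_trace_mul_le_re_trace_mul {A B C : Matrix ι ι ℂ} (hA : 0 ≤ A) (hBC : B ≤ C) :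
    (A * B).trace.re ≤ (A * C).trace.re := by
  have := re_trace_mul_nonneg hA (sub_nonneg.2 hBC)
  rw [mul_sub, Matrix.trace_sub, Complex.sub_re] at this
  linarith

theorem re_trace_mono {A B : Matrix ι ι ℂ} (h : A ≤ B) : A.trace.re ≤ B.trace.re := by
  simpa using re_trace_mul_le_re_trace_mul (A := (1 : Matrix ι ι ℂ)) zero_le_one h

theorem abs_le_of_mem_spectrum {A : Matrix ι ι ℂ} (hA : IsSelfAdjoint A) {b t : ℝ}
    (hb : ‖A‖ ≤ b) (ht : t ∈ spectrum ℝ A) : |t| ≤ b := by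
  have h1 := (le_algebraMap_iff_spectrum_le hA).1 hA.le_algebraMap_norm_self t ht
  have h2 := hA.neg_algebraMap_norm_le_self
  rw [← map_neg] at h2
  have h3 := (algebraMap_le_iff_le_spectrum hA).1 h2 t ht
  exact abs_le.2 ⟨by linarith, by linarith⟩

theorem exp_nonneg {A : Matrix ι ι ℂ} (hA : IsSelfAdjoint A) : 0 ≤ NormedSpace.exp A := by
  rw [← CFC.real_exp_eq_normedSpace_exp hA]
  exact cfc_nonneg fun x _ => (Real.exp_pos x).le

theorem one_add_le_exp {A : Matrix ι ι ℂ} (hA : IsSelfAdjoint A) :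
    1 + A ≤ NormedSpace.exp A := by
  have h : cfc (fun x : ℝ => 1 + x) A = 1 + A := by
    rw [cfc_const_add 1 (fun x => x) A, cfc_id' ℝ A, map_one]
  rw [← h, ← CFC.real_exp_eq_normedSpace_exp hA]
  exact cfc_mono fun x _ => by linarith [Real.add_one_le_exp x]

/-- The spectrum of `A` lies in `[-b, b]`, so the scalar inequality passes through the functional
calculus. -/
theorem exp_le_one_add_add {A : Matrix ι ι ℂ} (hA : IsSelfAdjoint A) {b g : ℝ} (hb : ‖A‖ ≤ b)
    (hg : ∀ t : ℝ, |t| ≤ b → Real.exp t ≤ 1 + t + g * t ^ 2) :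
    NormedSpace.exp A ≤ 1 + A + g • (A * A) := by
  have h : cfc (fun x : ℝ => (1 + x) + g * x ^ 2) A = 1 + A + g • (A * A) := by
    rw [cfc_add A (fun x : ℝ => 1 + x) (fun x => g * x ^ 2), cfc_const_add 1 (fun x => x) A,
      cfc_id' ℝ A, map_one, cfc_const_mul g (fun x => x ^ 2) A, cfc_pow_id A 2, sq]
  rw [← h, ← CFC.real_exp_eq_normedSpace_exp hA]
  exact cfc_mono fun x hx => hg x (abs_le_of_mem_spectrum hA hb hx)

theorem norm_le_of_neg_le_of_le {A : Matrix ι ι ℂ} {b : ℝ} (hb : 0 ≤ b) (hA : IsSelfAdjoint A)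
    (h1 : -algebraMap ℝ (Matrix ι ι ℂ) b ≤ A) (h2 : A ≤ algebraMap ℝ (Matrix ι ι ℂ) b) :
    ‖A‖ ≤ b := by
  rcases isEmpty_or_nonempty ι with h | h
  · rw [Subsingleton.elim A 0, norm_zero]; exact hb
  rw [← map_neg] at h1
  rcases CStarAlgebra.norm_or_neg_norm_mem_spectrum hA with h | h
  · exact (le_algebraMap_iff_spectrum_le hA).1 h2 _ h
  · linarith [(algebraMap_le_iff_le_spectrum hA).1 h1 _ h]

/-- If a Hermitian matrix has an eigenvalue above `τ`, then `tr (exp A - 1 - A)` is at least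
`exp τ - 1 - τ`. -/
theorem le_algebraMap_or_le_trace {A : Matrix ι ι ℂ} (hA : A.IsHermitian) {τ : ℝ} (hτ : 0 ≤ τ) :
    A ≤ algebraMap ℝ (Matrix ι ι ℂ) τ ∨
      Real.exp τ - 1 - τ ≤ (NormedSpace.exp A).trace.re - Fintype.card ι - A.trace.re := by
  by_cases hle : ∀ i, hA.eigenvalues i ≤ τ
  · left
    rw [le_algebraMap_iff_spectrum_le (ha := hA), hA.spectrum_real_eq_range_eigenvalues]
    rintro _ ⟨i, rfl⟩
    exact hle i
  · right
    push Not at hle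
    obtain ⟨i, hi⟩ := hle
    have htr : (NormedSpace.exp A).trace = ∑ j, (Real.exp (hA.eigenvalues j) : ℂ) := by
      have hs := hA.spectral_theorem
      set U : Matrix ι ι ℂ := (hA.eigenvectorUnitary : Matrix ι ι ℂ) with hU
      have hUinv : U⁻¹ = star U := Matrix.inv_eq_left_inv (by simp [hU])
      have hs' : A = U * Matrix.diagonal (fun j => (hA.eigenvalues j : ℂ)) * U⁻¹ := by
        rw [hUinv]; exact hs
      have hunit : IsUnit U := (Unitary.toUnits hA.eigenvectorUnitary).isUnit
      rw [congrArg (fun B : Matrix ι ι ℂ => (NormedSpace.exp B).trace) hs', Matrix.exp_conj _ _ hunit, Matrix.exp_diagonal, mul_assoc, Matrix.trace_mul_comm,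
        mul_assoc, Matrix.nonsing_inv_mul _ ((Matrix.isUnit_iff_isUnit_det _).1 hunit), mul_one,
        Matrix.trace_diagonal]
      refine Finset.sum_congr rfl fun j _ => ?_
      rw [Pi.coe_exp, ← Complex.exp_eq_exp_ℂ, Complex.ofReal_exp]
    rw [htr, hA.trace_eq_sum_eigenvalues, Complex.re_sum, Complex.re_sum]
    have hcard : (Fintype.card ι : ℝ) = ∑ _j : ι, (1 : ℝ) := by simp
    rw [hcard, ← Finset.sum_sub_distrib, ← Finset.sum_sub_distrib]
    -- Every eigenvalue contributes a nonnegative amount `exp λ - 1 - λ`, so the one above `τ` can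
    -- be kept alone.
    have h0 : ∀ j ∈ Finset.univ, 0 ≤ ((Real.exp (hA.eigenvalues j) : ℂ)).re - 1
        - ((hA.eigenvalues j : ℂ)).re := fun j _ => by
      rw [Complex.ofReal_re, Complex.ofReal_re]
      linarith [Real.add_one_le_exp (hA.eigenvalues j)]
    refine le_trans ?_ (Finset.single_le_sum h0 (Finset.mem_univ i))
    rw [Complex.ofReal_re, Complex.ofReal_re]
    have h1 : Real.exp (hA.eigenvalues i) = Real.exp τ * Real.exp (hA.eigenvalues i - τ) := by
      rw [← Real.exp_add]; ring_nf
    nlinarith [Real.add_one_le_exp (hA.eigenvalues i - τ), Real.one_le_exp hτ,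
      Real.exp_pos τ]

end FunctionalCalculus

/-! ### The trace moment generating function of an independent sum. -/

section Bernstein

variable {ι : Type*} [Fintype ι] [DecidableEq ι]

/-- The `(i, j)` entry as a continuous linear map. -/
noncomputable def entryCLM (i j : ι) : Matrix ι ι ℂ →L[ℝ] ℂ :=
  LinearMap.toContinuousLinearMap (Matrix.entryLinearMap ℝ ℂ i j)

@[simp] theorem entryCLM_apply (i j : ι) (A : Matrix ι ι ℂ) : entryCLM i j A = A i j := rfl

/-- `A ↦ Re tr (A * C)` as a continuous linear map. -/
noncomputable def traceMulCLM (C : Matrix ι ι ℂ) : Matrix ι ι ℂ →L[ℝ] ℝ :=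
  LinearMap.toContinuousLinearMap
    (Complex.reLm ∘ₗ Matrix.traceLinearMap ι ℝ ℂ ∘ₗ LinearMap.mulRight ℝ C)

@[simp] theorem traceMulCLM_apply (C A : Matrix ι ι ℂ) :
    traceMulCLM C A = (A * C).trace.re := rfl

variable {Ω : Type*} [MeasurableSpace Ω] {P : Measure Ω}

theorem integrable_re_trace_mul {A : Ω → Matrix ι ι ℂ} (hA : Integrable A P)
    (C : Matrix ι ι ℂ) : Integrable (fun ω => (A ω * C).trace.re) P :=
  (traceMulCLM C).integrable_comp hA

theorem integrable_re_trace {A : Ω → Matrix ι ι ℂ} (hA : Integrable A P) :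
    Integrable (fun ω => (A ω).trace.re) P := by
  simpa using integrable_re_trace_mul hA 1

theorem re_trace_mul_eq_sum (A B : Matrix ι ι ℂ) :
    (A * B).trace.re = ∑ i, ∑ j, (A i j * B j i).re := by
  simp [Matrix.trace, Matrix.mul_apply]

theorem integrable_re_trace_mul_of_indep {A W : Ω → Matrix ι ι ℂ} (hA : Integrable A P)
    (hW : Integrable W P)
    (hind : ∀ i j k l, IndepFun (fun ω => A ω i j) (fun ω => W ω k l) P) :
    Integrable (fun ω => (A ω * W ω).trace.re) P := by
  simp only [re_trace_mul_eq_sum]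
  refine integrable_finsetSum _ fun i _ => integrable_finsetSum _ fun j _ => ?_
  exact ((hind i j j i).integrable_mul ((entryCLM i j).integrable_comp hA)
    ((entryCLM j i).integrable_comp hW)).re

/-- Independence and means are required entrywise, so that the expanded trace reduces to the scalar
product rule for independent variables. -/
theorem integral_re_trace_mul_of_indep {A W : Ω → Matrix ι ι ℂ} (hA : Integrable A P)
    (hW : Integrable W P)
    (hind : ∀ i j k l, IndepFun (fun ω => A ω i j) (fun ω => W ω k l) P)
    {V : Matrix ι ι ℂ} (hV : ∀ i j, ∫ ω, W ω i j ∂P = V i j) :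
    ∫ ω, (A ω * W ω).trace.re ∂P = ∫ ω, (A ω * V).trace.re ∂P := by
  have hAe := fun i j => (entryCLM i j).integrable_comp hA
  have hWe := fun i j => (entryCLM i j).integrable_comp hW
  simp only [entryCLM_apply] at hAe hWe
  have hi : ∀ i j, Integrable (fun ω => A ω i j * W ω j i) P := fun i j =>
    (hind i j j i).integrable_mul (hAe i j) (hWe j i)
  have hr1 : ∀ i j, Integrable (fun ω => (A ω i j * W ω j i).re) P := fun i j => (hi i j).re
  have hr2 : ∀ i j, Integrable (fun ω => (A ω i j * V j i).re) P := fun i j =>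
    ((hAe i j).mul_const (V j i)).re
  simp only [re_trace_mul_eq_sum]
  rw [integral_finsetSum _ fun i _ => integrable_finsetSum _ fun j _ => hr1 i j,
    integral_finsetSum _ fun i _ => integrable_finsetSum _ fun j _ => hr2 i j]
  refine Finset.sum_congr rfl fun i _ => ?_
  rw [integral_finsetSum _ fun j _ => hr1 i j, integral_finsetSum _ fun j _ => hr2 i j]
  refine Finset.sum_congr rfl fun j _ => ?_
  have h1 := integral_re (hi i j)
  have h2 := integral_re ((hAe i j).mul_const (V j i))
  simp only [RCLike.re_to_complex] at h1 h2
  rw [h1, h2, (hind i j j i).integral_fun_mul_eq_mul_integral (hAe i j).aestronglyMeasurable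
    (hWe j i).aestronglyMeasurable, hV, integral_mul_const]

variable [IsProbabilityMeasure P] {S : Type*} [MeasurableSpace S] {κ : Type*}
  {x : κ → Ω → S} {F : S → Matrix ι ι ℂ}

theorem continuous_exp_matrix : Continuous (NormedSpace.exp : Matrix ι ι ℂ → Matrix ι ι ℂ) := by
  let _ : NormedAlgebra ℚ (Matrix ι ι ℂ) := NormedAlgebra.restrictScalars ℚ ℝ _
  exact NormedSpace.exp_continuous

/-- Closed balls of matrices are compact, so `f` is bounded on the range of `A`. -/
theorem integrable_comp_of_bounded {E : Type*} [NormedAddCommGroup E]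
    {f : Matrix ι ι ℂ → E} (hf : Continuous f) {A : Ω → Matrix ι ι ℂ}
    (hA : StronglyMeasurable A) {c : ℝ} (hc : ∀ ω, ‖A ω‖ ≤ c) :
    Integrable (fun ω => f (A ω)) P := by
  obtain ⟨C, hC⟩ := (isCompact_closedBall (0 : Matrix ι ι ℂ) c).exists_bound_of_continuousOn
    hf.continuousOn
  exact Integrable.of_bound (hf.comp_stronglyMeasurable hA).aestronglyMeasurable C
    (ae_of_all _ fun ω => hC _ (by simpa using hc ω))

theorem indepFun_entry_sum [DecidableEq κ] (hx : ∀ k, Measurable (x k)) (hind : iIndepFun x P)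
    (hF : StronglyMeasurable F) {σ : Finset κ} {k : κ} (hk : k ∉ σ)
    {f h : Matrix ι ι ℂ → ℂ} (hf : Continuous f) (hh : Continuous h) :
    IndepFun (fun ω => f (∑ j ∈ σ, F (x j ω))) (fun ω => h (F (x k ω))) P := by
  have h1 := hind.indepFun_finset σ {k} (Finset.disjoint_singleton_right.2 hk) hx
  have hm1 : Measurable fun p : σ → S => f (∑ j, F (p j)) := by
    refine (hf.comp_stronglyMeasurable (Finset.stronglyMeasurable_fun_sum _ fun j _ => ?_)).measurable
    exact hF.comp_measurable (measurable_pi_apply j)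
  have hm2 : Measurable fun p : ({k} : Finset κ) → S => h (F (p ⟨k, by simp⟩)) :=
    (hh.comp_stronglyMeasurable (hF.comp_measurable (measurable_pi_apply _))).measurable
  have h2 := h1.comp hm1 hm2
  refine h2.congr (ae_of_all _ fun ω => ?_) (ae_of_all _ fun ω => rfl)
  exact congrArg f (Finset.sum_coe_sort σ fun j => F (x j ω))

/-- Bound on the trace moment generating function of a sum of independent centred matrices. -/
theorem integral_trace_exp_sum_le [DecidableEq κ] (hx : ∀ k, Measurable (x k))
    (hind : iIndepFun x P) (hF : StronglyMeasurable F) (hsa : ∀ s, IsSelfAdjoint (F s))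
    {b : ℝ} (hb : ∀ s, ‖F s‖ ≤ b) (h0 : ∀ k i j, ∫ ω, F (x k ω) i j ∂P = 0)
    {g : ℝ} (hg0 : 0 ≤ g) (hg : ∀ t : ℝ, |t| ≤ b → Real.exp t ≤ 1 + t + g * t ^ 2)
    {T V : Matrix ι ι ℂ} (hT1 : T ≤ 1) {v : ℝ} (hv : 0 ≤ v)
    (hV : ∀ k i j, ∫ ω, (F (x k ω) * F (x k ω)) i j ∂P = V i j) (hVT : V ≤ v • T)
    (σ : Finset κ) :
    ∫ ω, (NormedSpace.exp (∑ j ∈ σ, F (x j ω))).trace.re ∂P - Fintype.card ι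
      ≤ T.trace.re * ((1 + g * v) ^ σ.card - 1) := by
  induction σ using Finset.induction_on with
  | empty => simp
  | insert k σ hk ih =>
    set A : Ω → Matrix ι ι ℂ := fun ω => ∑ j ∈ σ, F (x j ω) with hA
    have hFm : ∀ j, StronglyMeasurable fun ω => F (x j ω) := fun j => hF.comp_measurable (hx j)
    have hAm : StronglyMeasurable A := Finset.stronglyMeasurable_fun_sum _ fun j _ => hFm j
    have hAb : ∀ ω, ‖A ω‖ ≤ σ.card * b := fun ω =>
      (norm_sum_le _ _).trans ((Finset.sum_le_card_nsmul _ _ _ fun j _ => hb _).trans_eq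
        (nsmul_eq_mul _ _))
    have hAsa : ∀ ω, IsSelfAdjoint (A ω) := fun ω => isSelfAdjoint_sum _ fun j _ => hsa _
    have hAi : Integrable A P := integrable_comp_of_bounded continuous_id hAm hAb
    have hEi : Integrable (fun ω => NormedSpace.exp (A ω)) P :=
      integrable_comp_of_bounded continuous_exp_matrix hAm hAb
    have hFi : ∀ j, Integrable (fun ω => F (x j ω)) P := fun j =>
      integrable_comp_of_bounded continuous_id (hFm j) fun ω => hb _
    have hF2i : Integrable (fun ω => F (x k ω) * F (x k ω)) P :=
      integrable_comp_of_bounded (continuous_id.mul continuous_id) (hFm k) fun ω => hb _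
    have hsq : Continuous fun Z : Matrix ι ι ℂ => Z * Z := continuous_id.mul continuous_id
    have hind1 : ∀ i j l l', IndepFun (fun ω => NormedSpace.exp (A ω) i j)
        (fun ω => F (x k ω) l l') P := fun i j l l' =>
      indepFun_entry_sum hx hind hF hk ((entryCLM i j).continuous.comp continuous_exp_matrix)
        (entryCLM l l').continuous
    have hind2 : ∀ i j l l', IndepFun (fun ω => NormedSpace.exp (A ω) i j)
        (fun ω => (F (x k ω) * F (x k ω)) l l') P := fun i j l l' =>
      indepFun_entry_sum hx hind hF hk ((entryCLM i j).continuous.comp continuous_exp_matrix)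
        ((entryCLM l l').continuous.comp hsq)
    have hstep : ∀ ω, (NormedSpace.exp (∑ j ∈ insert k σ, F (x j ω))).trace.re
        ≤ (NormedSpace.exp (A ω)).trace.re + (NormedSpace.exp (A ω) * F (x k ω)).trace.re
          + g * (NormedSpace.exp (A ω) * (F (x k ω) * F (x k ω))).trace.re := fun ω => by
      rw [Finset.sum_insert hk, add_comm]
      have h1 := norm_trace_exp_add_le (hAsa ω) (hsa (x k ω))
      have hnn := re_trace_mul_nonneg (exp_nonneg (hAsa ω)) (exp_nonneg (hsa (x k ω)))
      -- Golden–Thompson bounds a norm; the trace of a product of two positive matrices is real and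
      -- nonnegative, hence equal to that norm.
      have him : (NormedSpace.exp (A ω) * NormedSpace.exp (F (x k ω))).trace.im = 0 := by
        rw [← Complex.conj_eq_iff_im, ← Complex.star_def, ← Matrix.trace_conjTranspose,
          Matrix.conjTranspose_mul, ← Matrix.star_eq_conjTranspose, ← Matrix.star_eq_conjTranspose,
          (exp_nonneg (hAsa ω)).isSelfAdjoint.star_eq,
          (exp_nonneg (hsa (x k ω))).isSelfAdjoint.star_eq, Matrix.trace_mul_comm]
      have hnorm : ‖(NormedSpace.exp (A ω) * NormedSpace.exp (F (x k ω))).trace‖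
          = (NormedSpace.exp (A ω) * NormedSpace.exp (F (x k ω))).trace.re := by
        rw [← Complex.re_add_im (Matrix.trace _), him]
        simp [abs_of_nonneg hnn]
      have h2 := re_trace_mul_le_re_trace_mul (exp_nonneg (hAsa ω))
        (exp_le_one_add_add (hsa (x k ω)) (hb _) hg)
      rw [mul_add, mul_add, mul_one, mul_smul_comm, Matrix.trace_add, Matrix.trace_add,
        Matrix.trace_smul, Complex.add_re, Complex.add_re, Complex.smul_re, smul_eq_mul] at h2
      have h3 := Complex.re_le_norm (NormedSpace.exp (A ω + F (x k ω))).trace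
      linarith
    have hi1 := integrable_re_trace hEi
    have hi2 := integrable_re_trace_mul_of_indep hEi (hFi k) hind1
    have hi3 := integrable_re_trace_mul_of_indep hEi hF2i hind2
    have hins : Integrable (fun ω => (NormedSpace.exp (∑ j ∈ insert k σ, F (x j ω))).trace.re) P := by
      refine integrable_re_trace (integrable_comp_of_bounded continuous_exp_matrix
        (Finset.stronglyMeasurable_fun_sum _ fun j _ => hFm j) (c := (insert k σ).card * b)
        fun ω => ?_)
      exact (norm_sum_le _ _).trans ((Finset.sum_le_card_nsmul _ _ _ fun j _ => hb _).trans_eq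
        (nsmul_eq_mul _ _))
    have hint := integral_mono hins ((hi1.add hi2).add (hi3.const_mul g)) hstep
    rw [integral_add' (hi1.add hi2) (hi3.const_mul g), integral_add' hi1 hi2,
      integral_const_mul,
      integral_re_trace_mul_of_indep hEi (hFi k) hind1 (V := 0) (fun i j => h0 k i j),
      integral_re_trace_mul_of_indep hEi hF2i hind2 (hV k)] at hint
    simp only [mul_zero, Matrix.trace_zero, Complex.zero_re, integral_zero, add_zero] at hint
    have hET := integrable_re_trace_mul hEi T
    have hAT := integrable_re_trace_mul hAi T
    have hAtr := integrable_re_trace hAi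
    have hEV : ∫ ω, (NormedSpace.exp (A ω) * V).trace.re ∂P
        ≤ v * ∫ ω, (NormedSpace.exp (A ω) * T).trace.re ∂P := by
      rw [← integral_const_mul]
      refine integral_mono (integrable_re_trace_mul hEi V) (hET.const_mul v) fun ω => ?_
      have := re_trace_mul_le_re_trace_mul (exp_nonneg (hAsa ω)) hVT
      rwa [mul_smul_comm, Matrix.trace_smul, Complex.smul_re, smul_eq_mul] at this
    have hmean : ∀ C : Matrix ι ι ℂ, ∫ ω, (A ω * C).trace.re ∂P = 0 := fun C => by
      have h1 := (traceMulCLM C).integral_comp_comm hAi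
      simp only [traceMulCLM_apply] at h1
      rw [h1, show ∫ ω, A ω ∂P = 0 from ?_]
      · simp
      rw [hA, integral_finsetSum _ fun j _ => hFi j]
      refine Finset.sum_eq_zero fun j _ => ?_
      ext i l
      have := (entryCLM i l).integral_comp_comm (hFi j)
      simp only [entryCLM_apply] at this
      rw [← this, h0, Matrix.zero_apply]
    -- This is where `tr T` replaces the dimension: `exp A - 1 - A ≥ 0` and `T ≤ 1` bound `tr ((exp
    -- A - 1 - A) T)` by `tr (exp A - 1 - A)`, and the terms linear in `A` have mean zero.
    have hTbound : ∫ ω, (NormedSpace.exp (A ω) * T).trace.re ∂P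
        ≤ T.trace.re + (∫ ω, (NormedSpace.exp (A ω)).trace.re ∂P - Fintype.card ι) := by
      have hpt : ∀ ω, (NormedSpace.exp (A ω) * T).trace.re ≤ T.trace.re + (A ω * T).trace.re
          + (NormedSpace.exp (A ω)).trace.re - Fintype.card ι - (A ω * 1).trace.re := fun ω => by
        have h1 := re_trace_mul_le_re_trace_mul (sub_nonneg.2 (one_add_le_exp (hAsa ω))) hT1
        simp only [sub_mul, add_mul, one_mul, mul_one, Matrix.trace_sub, Matrix.trace_add,
          Matrix.trace_one, Complex.sub_re, Complex.add_re, Complex.natCast_re] at h1 ⊢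
        linarith
      have hc := integrable_const (μ := P) (Fintype.card ι : ℝ)
      have hc' := integrable_const (μ := P) T.trace.re
      have hA1 := integrable_re_trace_mul hAi (1 : Matrix ι ι ℂ)
      refine (integral_mono hET ((((hc'.add hAT).add hi1).sub hc).sub hA1) hpt).trans_eq ?_
      rw [integral_sub' (((hc'.add hAT).add hi1).sub hc) hA1,
        integral_sub' ((hc'.add hAT).add hi1) hc, integral_add' (hc'.add hAT) hi1,
        integral_add' hc' hAT, hmean, hmean, integral_const, integral_const]
      simp
      ring
    rw [Finset.card_insert_of_notMem hk, pow_succ]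
    set a := ∫ ω, (NormedSpace.exp (A ω)).trace.re ∂P
    have hgv : 0 ≤ g * v := mul_nonneg hg0 hv
    -- With `e` the excess of the expected trace over the dimension, the recursion is `e' ≤ (1 + g
    -- v) e + g v tr T`, whose solution from `e = 0` is the claimed bound.
    have h4 : g * ∫ ω, (NormedSpace.exp (A ω) * V).trace.re ∂P
        ≤ g * v * (T.trace.re + (a - Fintype.card ι)) := by
      rw [mul_assoc]
      exact mul_le_mul_of_nonneg_left (hEV.trans (mul_le_mul_of_nonneg_left hTbound hv)) hg0
    nlinarith [mul_le_mul_of_nonneg_right ih hgv]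

end Bernstein

/-! ### From the moment bound to a tail bound. -/

section BernsteinTail

/-- Bernstein's constant `(1/2) / (1 - b/3)` at `b = Δ / (1 + Δ/3)` equals `(1 + Δ/3) / 2`. The
Taylor remainder of order four fits since `5/96 ≤ 1/18`. -/
theorem exp_le_one_add_add_sq {Δ t : ℝ} (h0 : 0 < Δ) (h1 : Δ < 1) (ht : |t| ≤ Δ / (1 + Δ / 3)) :
    Real.exp t ≤ 1 + t + (1 + Δ / 3) / 2 * t ^ 2 := by
  set b := Δ / (1 + Δ / 3) with hb
  have hb0 : 0 < b := by positivity
  have hbΔ : b * (1 + Δ / 3) = Δ := by rw [hb]; field_simp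
  have hb1 : b ≤ 3 / 4 := by nlinarith
  have hg : 1 + b / 3 + b ^ 2 / 9 ≤ 1 + Δ / 3 := by
    have h5 : (1 - b / 3) * (1 + Δ / 3) = 1 := by linarith
    have h6 : 0 < 1 - b / 3 := by linarith
    have h7 : (1 - b / 3) * (1 + b / 3 + b ^ 2 / 9) ≤ 1 := by nlinarith [pow_pos hb0 3]
    nlinarith
  have h2 := (abs_le.1 (Real.exp_bound (x := t) (by linarith) (n := 4) (by norm_num))).2
  have h3 : |t| ^ 4 = t ^ 4 := by rw [← abs_pow]; exact abs_of_nonneg (by positivity)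
  rw [h3] at h2
  norm_num [Finset.sum_range_succ, Nat.factorial] at h2
  have h4 : t ^ 2 ≤ b ^ 2 := sq_le_sq' (by linarith [(abs_le.1 ht).1]) (abs_le.1 ht).2
  have h5 := (abs_le.1 ht).2
  nlinarith [mul_nonneg (sq_nonneg t) (sub_nonneg.2 h5), mul_nonneg (sq_nonneg t) (sub_nonneg.2 h4),
    mul_nonneg (sq_nonneg t) (sub_nonneg.2 hg), sq_nonneg t, sq_nonneg (t ^ 2)]

theorem half_exp_le {τ : ℝ} (h : 4 ≤ τ) : Real.exp τ / 2 ≤ Real.exp τ - 1 - τ := by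
  nlinarith [Real.quadratic_le_exp_of_nonneg (by linarith : 0 ≤ τ)]

variable {ι : Type*} [Fintype ι] [DecidableEq ι] {Ω : Type*} [MeasurableSpace Ω] {P : Measure Ω}
  [IsProbabilityMeasure P] {S : Type*} [MeasurableSpace S] {κ : Type*} [Fintype κ]
  {x : κ → Ω → S} {F : S → Matrix ι ι ℂ}

/-- A **matrix Bernstein inequality** with intrinsic dimension `tr T`. -/
theorem measureReal_not_sum_le_le [Nonempty κ] (hx : ∀ k, Measurable (x k))
    (hind : iIndepFun x P) (hF : StronglyMeasurable F) (hsa : ∀ s, IsSelfAdjoint (F s))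
    {L : ℝ} (hL : 0 < L) (hb : ∀ s, ‖F s‖ ≤ L) (h0 : ∀ k i j, ∫ ω, F (x k ω) i j ∂P = 0)
    {T V : Matrix ι ι ℂ} (hT0 : 0 ≤ T) (hT1 : T ≤ 1)
    (hV : ∀ k i j, ∫ ω, (F (x k ω) * F (x k ω)) i j ∂P = V i j)
    (hVT : V ≤ (L / Fintype.card κ) • T)
    {Δ : ℝ} (hΔ0 : 0 < Δ) (hΔ1 : Δ < 1) {τ : ℝ} (hτ : τ = Δ ^ 2 / (L * (1 + Δ / 3)))
    (hτ4 : 4 ≤ τ) :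
    P.real {ω | ¬ ∑ k, F (x k ω) ≤ algebraMap ℝ (Matrix ι ι ℂ) Δ}
      ≤ 2 * T.trace.re * Real.exp (-(τ / 2)) := by
  classical
  have hκ : (0 : ℝ) < Fintype.card κ := by exact_mod_cast Fintype.card_pos
  -- This `θ` minimizes `-θ Δ + θ² L (1 + Δ/3) / 2`, the minimum being `-τ/2`.
  set θ : ℝ := Δ / (L * (1 + Δ / 3)) with hθ
  have hθ0 : 0 < θ := by positivity
  have hθΔ : θ * Δ = τ := by rw [hθ, hτ]; field_simp
  have hb' : ∀ s, ‖θ • F s‖ ≤ Δ / (1 + Δ / 3) := fun s => by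
    rw [norm_smul, Real.norm_of_nonneg hθ0.le]
    refine (mul_le_mul_of_nonneg_left (hb s) hθ0.le).trans_eq ?_
    rw [hθ]; field_simp
  have hsa' : ∀ s, IsSelfAdjoint (θ • F s) := fun s => (IsSelfAdjoint.all θ).smul (hsa s)
  have hF' : StronglyMeasurable fun s => θ • F s := hF.const_smul θ
  have h0' : ∀ k i j, ∫ ω, (θ • F (x k ω)) i j ∂P = 0 := fun k i j => by
    simp only [Matrix.smul_apply]
    rw [integral_smul, h0, smul_zero]
  have hV' : ∀ k i j, ∫ ω, ((θ • F (x k ω)) * (θ • F (x k ω))) i j ∂P = (θ ^ 2 • V) i j :=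
    fun k i j => by
      simp only [smul_mul_smul_comm, Matrix.smul_apply]
      rw [integral_smul, hV, sq]
  set v : ℝ := θ ^ 2 * (L / Fintype.card κ) with hv
  have hVT' : θ ^ 2 • V ≤ v • T := by
    rw [hv, mul_smul]
    exact smul_le_smul_of_nonneg_left hVT (by positivity)
  have hmain := integral_trace_exp_sum_le hx hind hF' hsa' hb' h0'
    (by positivity : 0 ≤ (1 + Δ / 3) / 2) (fun t ht => exp_le_one_add_add_sq hΔ0 hΔ1 ht) hT1
    (by positivity : 0 ≤ v) hV' hVT' Finset.univ
  set A : Ω → Matrix ι ι ℂ := fun ω => ∑ k, θ • F (x k ω) with hA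
  have hFm : ∀ j, StronglyMeasurable fun ω => θ • F (x j ω) := fun j =>
    hF'.comp_measurable (hx j)
  have hAm : StronglyMeasurable A := Finset.stronglyMeasurable_fun_sum _ fun j _ => hFm j
  have hAb : ∀ ω, ‖A ω‖ ≤ (Finset.univ : Finset κ).card * (Δ / (1 + Δ / 3)) := fun ω =>
    (norm_sum_le _ _).trans ((Finset.sum_le_card_nsmul _ _ _ fun j _ => hb' _).trans_eq
      (nsmul_eq_mul _ _))
  have hAsa : ∀ ω, IsSelfAdjoint (A ω) := fun ω => isSelfAdjoint_sum _ fun j _ => hsa' _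
  have hAi : Integrable A P := integrable_comp_of_bounded continuous_id hAm hAb
  have hEi : Integrable (fun ω => NormedSpace.exp (A ω)) P :=
    integrable_comp_of_bounded continuous_exp_matrix hAm hAb
  have hi1 := integrable_re_trace hEi
  have hi2 := integrable_re_trace hAi
  have htrA : ∫ ω, (A ω).trace.re ∂P = 0 := by
    have h1 := (traceMulCLM (1 : Matrix ι ι ℂ)).integral_comp_comm hAi
    simp only [traceMulCLM_apply, mul_one] at h1
    have hFi : ∀ j, Integrable (fun ω => θ • F (x j ω)) P := fun j =>
      integrable_comp_of_bounded (f := id) (A := fun ω => θ • F (x j ω)) continuous_id (hFm j)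
        fun ω => hb' _
    rw [h1, show ∫ ω, A ω ∂P = 0 from ?_]
    · simp
    rw [hA, integral_finsetSum _ fun j _ => hFi j]
    refine Finset.sum_eq_zero fun j _ => ?_
    ext i l
    have := (entryCLM i l).integral_comp_comm (hFi j)
    simp only [entryCLM_apply] at this
    rw [← this, h0', Matrix.zero_apply]
  set h : Ω → ℝ := fun ω => (NormedSpace.exp (A ω)).trace.re - Fintype.card ι - (A ω).trace.re
    with hh
  have hhi : Integrable h P := (hi1.sub (integrable_const _)).sub hi2
  have hh0 : 0 ≤ᵐ[P] h := ae_of_all _ fun ω => by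
    have := re_trace_mono (one_add_le_exp (hAsa ω))
    simp only [Matrix.trace_add, Matrix.trace_one, Complex.add_re, Complex.natCast_re] at this
    simp only [hh, Pi.zero_apply]
    linarith
  have hhint : ∫ ω, h ω ∂P = ∫ ω, (NormedSpace.exp (A ω)).trace.re ∂P - Fintype.card ι := by
    have hc := integrable_const (μ := P) (Fintype.card ι : ℝ)
    have e := integral_sub' (hi1.sub hc) hi2
    rw [integral_sub' hi1 hc, htrA, integral_const] at e
    refine e.trans ?_
    simp
  -- Subtracting `1 + A` inside the trace leaves an expectation proportional to `tr T`, at the price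
  -- of the level `exp τ - 1 - τ`, which is at least `exp τ / 2` for `τ ≥ 4`.
  have hmarkov := mul_meas_ge_le_integral_of_nonneg hh0 hhi (Real.exp τ - 1 - τ)
  have hsub : {ω | ¬ ∑ k, F (x k ω) ≤ algebraMap ℝ (Matrix ι ι ℂ) Δ}
      ⊆ {ω | Real.exp τ - 1 - τ ≤ h ω} := fun ω hω => by
    rcases le_algebraMap_or_le_trace (hAsa ω) (by linarith : 0 ≤ τ) with hle | hle
    · refine absurd ?_ hω
      have h3 := smul_le_smul_of_nonneg_left hle (inv_nonneg.2 hθ0.le)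
      rw [hA] at h3
      simp only [← Finset.smul_sum] at h3
      rw [inv_smul_smul₀ hθ0.ne', ← hθΔ, map_mul, ← Algebra.smul_def, inv_smul_smul₀ hθ0.ne'] at h3
      exact h3
    · exact hle
  have hp := measureReal_mono (μ := P) hsub
  rw [hhint] at hmarkov
  have hpow : (1 + (1 + Δ / 3) / 2 * v) ^ (Finset.univ : Finset κ).card ≤ Real.exp (τ / 2) := by
    have h5 : Real.exp (τ / 2)
        = Real.exp ((1 + Δ / 3) / 2 * v) ^ (Finset.univ : Finset κ).card := by
      rw [← Real.exp_nat_mul, Finset.card_univ, hv, hθ, hτ]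
      congr 1
      field_simp
    rw [h5]
    refine pow_le_pow_left₀ (by positivity) ?_ _
    linarith [Real.add_one_le_exp ((1 + Δ / 3) / 2 * v)]
  have hT : 0 ≤ T.trace.re := by simpa using re_trace_mono hT0
  have hhalf := half_exp_le hτ4
  have hp0 : 0 ≤ P.real {ω | ¬ ∑ k, F (x k ω) ≤ algebraMap ℝ (Matrix ι ι ℂ) Δ} :=
    measureReal_nonneg
  set p := P.real {ω | ¬ ∑ k, F (x k ω) ≤ algebraMap ℝ (Matrix ι ι ℂ) Δ}
  have hfin : Real.exp τ / 2 * p ≤ T.trace.re * Real.exp (τ / 2) := by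
    calc Real.exp τ / 2 * p ≤ (Real.exp τ - 1 - τ) * P.real {ω | Real.exp τ - 1 - τ ≤ h ω} :=
          mul_le_mul hhalf hp hp0 (by linarith [Real.exp_pos τ])
      _ ≤ T.trace.re * ((1 + (1 + Δ / 3) / 2 * v) ^ (Finset.univ : Finset κ).card - 1) :=
          hmarkov.trans hmain
      _ ≤ T.trace.re * Real.exp (τ / 2) := mul_le_mul_of_nonneg_left (by linarith) hT
  have he : Real.exp τ = Real.exp (τ / 2) * Real.exp (τ / 2) := by
    rw [← Real.exp_add]; ring_nf
  rw [he] at hfin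
  rw [Real.exp_neg, ← div_eq_mul_inv, le_div_iff₀ (Real.exp_pos _)]
  have := Real.exp_pos (τ / 2)
  refine le_of_mul_le_mul_right ?_ this
  linarith

end BernsteinTail

/-! ### Concentration for sums of positive matrices. -/

section PositiveSums

variable {ι : Type*} [Fintype ι] [DecidableEq ι]

theorem mul_self_le_smul {Y : Matrix ι ι ℂ} {L : ℝ} (hY0 : 0 ≤ Y)
    (hYL : Y ≤ algebraMap ℝ (Matrix ι ι ℂ) L) : Y * Y ≤ L • Y := by
  have hsa : IsSelfAdjoint Y := hY0.isSelfAdjoint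
  have h0 : ∀ t ∈ spectrum ℝ Y, 0 ≤ t := fun t ht => spectrum_nonneg_of_nonneg hY0 ht
  have h1 := (le_algebraMap_iff_spectrum_le hsa).1 hYL
  have e1 : cfc (fun t : ℝ => t ^ 2) Y = Y * Y := by rw [cfc_pow_id Y 2, sq]
  have e2 : cfc (fun t : ℝ => L * t) Y = L • Y := cfc_const_mul_id L Y
  rw [← e1, ← e2]
  exact cfc_mono fun t ht => by nlinarith [h0 t ht, h1 t ht]

variable {Ω : Type*} [MeasurableSpace Ω] {P : Measure Ω} [IsProbabilityMeasure P]
  {S : Type*} [MeasurableSpace S] {μ : Measure S} [IsProbabilityMeasure μ]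
  {κ : Type*} [Fintype κ] [Nonempty κ] {x : κ → Ω → S} {Y : S → Matrix ι ι ℂ}

/-- The summands are centred and multiplied by `σ`, which covers both tails. Since `0 ≤ Y ≤ L` gives
`Y² ≤ L Y`, the variance is at most `L` times the mean, that is `(L / card κ) T`: the form required
by the Bernstein bound. -/
theorem measureReal_not_signed_sum_le_le (hx : ∀ k, Measurable (x k)) (hind : iIndepFun x P)
    (hlaw : ∀ k, P.map (x k) = μ) (hY : StronglyMeasurable Y) {L : ℝ} (hL : 0 < L)
    (hY0 : ∀ s, 0 ≤ Y s) (hYL : ∀ s, Y s ≤ algebraMap ℝ (Matrix ι ι ℂ) L)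
    {T : Matrix ι ι ℂ} (hT0 : 0 ≤ T) (hT1 : T ≤ 1)
    (hmean : ∫ s, Y s ∂μ = (Fintype.card κ : ℝ)⁻¹ • T)
    {Δ : ℝ} (hΔ0 : 0 < Δ) (hΔ1 : Δ < 1) {τ : ℝ} (hτ : τ = Δ ^ 2 / (L * (1 + Δ / 3)))
    (hτ4 : 4 ≤ τ) {σ : ℝ} (hσ : σ = 1 ∨ σ = -1) :
    P.real {ω | ¬ σ • (∑ k, Y (x k ω) - T) ≤ algebraMap ℝ (Matrix ι ι ℂ) Δ}
      ≤ 2 * T.trace.re * Real.exp (-(τ / 2)) := by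
  set c : ℝ := (Fintype.card κ : ℝ)⁻¹ with hc
  have hκ : (0 : ℝ) < Fintype.card κ := by exact_mod_cast Fintype.card_pos
  have hc0 : 0 < c := inv_pos.2 hκ
  have hYb : ∀ s, ‖Y s‖ ≤ L := fun s =>
    (CStarAlgebra.norm_le_iff_le_algebraMap (Y s) hL.le (hY0 s)).2 (hYL s)
  have hYi : Integrable Y μ := integrable_comp_of_bounded (f := id) continuous_id hY hYb
  have hcT0 : 0 ≤ c • T := smul_nonneg hc0.le hT0
  have hcTL : c • T ≤ algebraMap ℝ (Matrix ι ι ℂ) L := by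
    rw [← hmean]
    refine (integral_mono hYi (integrable_const _) hYL).trans_eq ?_
    simp
  set F : S → Matrix ι ι ℂ := fun s => σ • (Y s - c • T) with hF
  have hFm : StronglyMeasurable F := (hY.sub stronglyMeasurable_const).const_smul σ
  have hDsa : ∀ s, IsSelfAdjoint (Y s - c • T) := fun s =>
    (hY0 s).isSelfAdjoint.sub hcT0.isSelfAdjoint
  have hFsa : ∀ s, IsSelfAdjoint (F s) := fun s => (IsSelfAdjoint.all σ).smul (hDsa s)
  have hFb : ∀ s, ‖F s‖ ≤ L := fun s => by
    have h1 : ‖F s‖ = ‖Y s - c • T‖ := by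
      change ‖σ • (Y s - c • T)‖ = _
      rw [norm_smul]
      rcases hσ with h | h <;> simp [h]
    rw [h1]
    refine norm_le_of_neg_le_of_le hL.le (hDsa s) ?_ ?_
    · calc -algebraMap ℝ (Matrix ι ι ℂ) L ≤ -(c • T) := neg_le_neg hcTL
        _ ≤ Y s - c • T := by rw [sub_eq_add_neg]; exact le_add_of_nonneg_left (hY0 s)
    · exact (sub_le_self _ hcT0).trans (hYL s)
  have hFi : Integrable F μ := integrable_comp_of_bounded (f := id) continuous_id hFm hFb
  have hF2i : Integrable (fun s => F s * F s) μ :=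
    integrable_comp_of_bounded (f := fun Z => Z * Z) (continuous_id.mul continuous_id) hFm hFb
  have hF0 : ∫ s, F s ∂μ = 0 := by
    rw [hF, integral_smul, integral_sub hYi (integrable_const _), hmean]
    simp
  have hentry : ∀ (f : S → Matrix ι ι ℂ), StronglyMeasurable f → Integrable f μ → ∀ k i j,
      ∫ ω, f (x k ω) i j ∂P = (∫ s, f s ∂μ) i j := fun f hf hfi k i j => by
    have h1 := (entryCLM i j).integral_comp_comm hfi
    simp only [entryCLM_apply] at h1
    have h2 := integral_map (μ := P) (hx k).aemeasurable (f := fun s => entryCLM i j (f s))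
      ((entryCLM i j).continuous.comp_stronglyMeasurable hf).aestronglyMeasurable
    rw [hlaw k] at h2
    exact h2.symm.trans h1
  have h0 : ∀ k i j, ∫ ω, F (x k ω) i j ∂P = 0 := fun k i j => by
    rw [hentry F hFm hFi, hF0, Matrix.zero_apply]
  have hV : ∀ k i j, ∫ ω, (F (x k ω) * F (x k ω)) i j ∂P = (∫ s, F s * F s ∂μ) i j :=
    fun k i j => hentry _ (hFm.mul hFm) hF2i k i j
  have hTT : 0 ≤ T * T := by simpa [hT0.isSelfAdjoint.star_eq] using star_mul_self_nonneg T
  have hYT := hYi.mul_const T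
  have hTY := hYi.const_mul T
  have hVT : ∫ s, F s * F s ∂μ ≤ (L / Fintype.card κ) • T := by
    have hpt : ∀ s, F s * F s ≤ L • Y s - c • (Y s * T) - c • (T * Y s) + (c ^ 2) • (T * T) :=
      fun s => by
        have h1 : F s * F s = Y s * Y s - c • (Y s * T) - c • (T * Y s) + (c ^ 2) • (T * T) := by
          have hσ2 : σ * σ = 1 := by rcases hσ with h | h <;> simp [h]
          have h2 : F s * F s = (Y s - c • T) * (Y s - c • T) := by
            change σ • (Y s - c • T) * σ • (Y s - c • T) = _
            rw [smul_mul_smul_comm, hσ2, one_smul]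
          rw [h2]
          simp only [sub_mul, mul_sub, smul_mul_assoc, mul_smul_comm, smul_sub, smul_smul, sq]
          abel
        rw [h1]
        exact add_le_add_left (sub_le_sub_right (sub_le_sub_right
          (mul_self_le_smul (hY0 s) (hYL s)) _) _) _
    have hi1 := hYi.smul L
    have hi2 := hYT.smul c
    have hi3 := hTY.smul c
    have hi4 := integrable_const (μ := μ) ((c ^ 2) • (T * T))
    have hmulT : ∫ s, Y s * T ∂μ = (c • T) * T := by
      rw [← hmean]; exact integral_mul_const_of_integrable hYi
    have hTmul : ∫ s, T * Y s ∂μ = T * (c • T) := by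
      rw [← hmean]; exact integral_const_mul_of_integrable hYi
    refine (integral_mono hF2i (((hi1.sub hi2).sub hi3).add hi4) hpt).trans ?_
    rw [integral_add' ((hi1.sub hi2).sub hi3) hi4, integral_sub' (hi1.sub hi2) hi3,
      integral_sub' hi1 hi2]
    simp only [Pi.smul_apply]
    rw [integral_smul, integral_smul, integral_smul, hmean, hmulT, hTmul, integral_const]
    simp only [smul_mul_assoc, mul_smul_comm, smul_smul, probReal_univ, one_mul]
    have hcc : 0 ≤ (c * c) • (T * T) := smul_nonneg (by positivity) hTT
    rw [sq, div_eq_mul_inv, sub_add_cancel]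
    exact sub_le_self _ hcc
  have h := measureReal_not_sum_le_le hx hind hFm hFsa hL hFb h0 hT0 hT1 hV hVT hΔ0 hΔ1 hτ hτ4
  have hsum : ∀ ω, ∑ k, F (x k ω) = σ • (∑ k, Y (x k ω) - T) := fun ω => by
    simp only [hF]
    rw [← Finset.smul_sum, Finset.sum_sub_distrib, Finset.sum_const, Finset.card_univ,
      ← Nat.cast_smul_eq_nsmul ℝ, smul_smul, hc, mul_inv_cancel₀ hκ.ne', one_smul]
  simpa only [hsum] using h

/-- Concentration of a sum of independent positive semidefinite matrices relative to a positive
definite matrix `H`. -/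
theorem measureReal_not_signed_sum_le_smul_le (hx : ∀ k, Measurable (x k)) (hind : iIndepFun x P)
    (hlaw : ∀ k, P.map (x k) = μ) (hY : StronglyMeasurable Y) {L : ℝ} (hL : 0 < L)
    {H : Matrix ι ι ℂ} (hH : IsStrictlyPositive H)
    (hY0 : ∀ s, 0 ≤ Y s) (hYi : Integrable Y μ) (hYL : ∀ s, Y s ≤ L • H)
    {G : Matrix ι ι ℂ} (hG0 : 0 ≤ G) (hGH : G ≤ H)
    (hmean : ∫ s, Y s ∂μ = (Fintype.card κ : ℝ)⁻¹ • G)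
    {Δ : ℝ} (hΔ0 : 0 < Δ) (hΔ1 : Δ < 1) {τ : ℝ} (hτ : τ = Δ ^ 2 / (L * (1 + Δ / 3)))
    (hτ4 : 4 ≤ τ) {σ : ℝ} (hσ : σ = 1 ∨ σ = -1) :
    P.real {ω | ¬ σ • (∑ k, Y (x k ω) - G) ≤ Δ • H}
      ≤ 2 * (G * H⁻¹).trace.re * Real.exp (-(τ / 2)) := by
  -- Whitening: with `H = C^* C`, conjugation by `C⁻¹` sends `H` to `1` and `G` to a matrix of trace
  -- `tr (G H⁻¹)`.
  obtain ⟨C, hC, rfl⟩ := CStarAlgebra.isStrictlyPositive_iff_eq_star_mul_self.1 hH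
  have hdet := (Matrix.isUnit_iff_isUnit_det C).1 hC
  have hCC : C * C⁻¹ = 1 := Matrix.mul_nonsing_inv C hdet
  have hCC' : C⁻¹ * C = 1 := Matrix.nonsing_inv_mul C hdet
  set D := C⁻¹ with hD
  have hstar1 : star D * star C = 1 := by rw [← star_mul, hCC, star_one]
  have hstar2 : star C * star D = 1 := by rw [← star_mul, hCC', star_one]
  have hone : star D * (star C * C) * D = 1 := by
    rw [← mul_assoc, hstar1, one_mul, hCC]
  have hcont : Continuous fun Z : Matrix ι ι ℂ => star D * Z * D := by fun_prop
  have hYDm : StronglyMeasurable fun s => star D * Y s * D := hcont.comp_stronglyMeasurable hY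
  have hscal : ∀ r : ℝ, star D * (r • (star C * C)) * D = algebraMap ℝ (Matrix ι ι ℂ) r :=
    fun r => by
      rw [mul_smul_comm, smul_mul_assoc, hone, Algebra.algebraMap_eq_smul_one]
  have hmeanD : ∫ s, star D * Y s * D ∂μ = (Fintype.card κ : ℝ)⁻¹ • (star D * G * D) := by
    rw [integral_mul_const_of_integrable (hYi.const_mul _), integral_const_mul_of_integrable hYi,
      hmean, mul_smul_comm, smul_mul_assoc]
  have h := measureReal_not_signed_sum_le_le hx hind hlaw hYDm hL
    (fun s => star_left_conjugate_nonneg (hY0 s) D)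
    (fun s => (star_left_conjugate_le_conjugate (hYL s) D).trans_eq (hscal L))
    (star_left_conjugate_nonneg hG0 D)
    ((star_left_conjugate_le_conjugate hGH D).trans_eq hone) hmeanD hΔ0 hΔ1 hτ hτ4 hσ
  have htr : (star D * G * D).trace = (G * (star C * C)⁻¹).trace := by
    rw [Matrix.trace_mul_comm, ← mul_assoc, Matrix.trace_mul_comm, Matrix.mul_inv_rev, ← hD,
      ← Matrix.inv_eq_left_inv hstar1]
  rw [htr] at h
  have hsub : {ω | ¬ σ • (∑ k, Y (x k ω) - G) ≤ Δ • (star C * C)}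
      ⊆ {ω | ¬ σ • (∑ k, star D * Y (x k ω) * D - star D * G * D)
        ≤ algebraMap ℝ (Matrix ι ι ℂ) Δ} := by
    intro ω hω hle
    refine absurd ?_ hω
    have h2 := star_left_conjugate_le_conjugate hle C
    have e1 : star C * algebraMap ℝ (Matrix ι ι ℂ) Δ * C = Δ • (star C * C) := by
      rw [Algebra.algebraMap_eq_smul_one, mul_smul_comm, smul_mul_assoc, mul_one]
    have e2 : ∀ Z : Matrix ι ι ℂ, star C * (star D * Z * D) * C = Z := fun Z => by
      rw [show star C * (star D * Z * D) * C = (star C * star D) * Z * (D * C) by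
        simp only [mul_assoc], hstar2, hCC', one_mul, mul_one]
    rw [e1, mul_smul_comm, smul_mul_assoc, ← Finset.sum_mul, ← Finset.mul_sum, ← sub_mul, ← mul_sub,
      e2] at h2
    exact h2
  exact (measureReal_mono hsub).trans h

end PositiveSums

/-! ### The quadratic form of an inverse matrix. -/

section InverseQuadraticForm

variable {ι : Type*} [Fintype ι] [DecidableEq ι]

/-- The quadratic form `v ↦ v^* H⁻¹ v`. -/
noncomputable def invQuad (H : Matrix ι ι ℂ) (v : ι → ℂ) : ℝ := (star v ⬝ᵥ (H⁻¹ *ᵥ v)).re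

theorem vecMulVec_star_nonneg (v : ι → ℂ) : 0 ≤ Matrix.vecMulVec v (star v) :=
  Matrix.nonneg_iff_posSemidef.2 (Matrix.posSemidef_vecMulVec_self_star v)

theorem trace_mul_vecMulVec_star (A : Matrix ι ι ℂ) (v : ι → ℂ) :
    (A * Matrix.vecMulVec v (star v)).trace = star v ⬝ᵥ (A *ᵥ v) := by
  rw [Matrix.mul_vecMulVec, Matrix.trace_vecMulVec, dotProduct_comm]

theorem invQuad_eq_trace (H : Matrix ι ι ℂ) (v : ι → ℂ) :
    invQuad H v = (H⁻¹ * Matrix.vecMulVec v (star v)).trace.re := by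
  rw [trace_mul_vecMulVec_star, invQuad]

theorem inv_nonneg_of_isStrictlyPositive {H : Matrix ι ι ℂ} (hH : IsStrictlyPositive H) :
    0 ≤ H⁻¹ :=
  Matrix.nonneg_iff_posSemidef.2 (Matrix.isStrictlyPositive_iff_posDef.1 hH).posSemidef.inv

theorem inv_le_inv_of_le {H K : Matrix ι ι ℂ} (hH : IsStrictlyPositive H) (h : H ≤ K) :
    K⁻¹ ≤ H⁻¹ := by
  rw [Matrix.nonsing_inv_eq_ringInverse, Matrix.nonsing_inv_eq_ringInverse]
  exact CStarAlgebra.ringInverse_le_ringInverse h hH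

theorem invQuad_nonneg {H : Matrix ι ι ℂ} (hH : IsStrictlyPositive H) (v : ι → ℂ) :
    0 ≤ invQuad H v := by
  rw [invQuad_eq_trace]
  exact re_trace_mul_nonneg (inv_nonneg_of_isStrictlyPositive hH) (vecMulVec_star_nonneg v)

theorem invQuad_anti {H K : Matrix ι ι ℂ} (hH : IsStrictlyPositive H) (h : H ≤ K) (v : ι → ℂ) :
    invQuad K v ≤ invQuad H v := by
  rw [invQuad_eq_trace, invQuad_eq_trace, Matrix.trace_mul_comm, Matrix.trace_mul_comm H⁻¹]
  exact re_trace_mul_le_re_trace_mul (vecMulVec_star_nonneg v) (inv_le_inv_of_le hH h)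

theorem invQuad_smul {H : Matrix ι ι ℂ} (hH : IsStrictlyPositive H) {c : ℝ} (hc : c ≠ 0)
    (v : ι → ℂ) : invQuad (c • H) v = c⁻¹ * invQuad H v := by
  have hdet := (Matrix.isUnit_iff_isUnit_det H).1 hH.isUnit
  have h : (c • H)⁻¹ = c⁻¹ • H⁻¹ := Matrix.inv_eq_left_inv (by
    rw [smul_mul_smul_comm, inv_mul_cancel₀ hc, one_smul, Matrix.nonsing_inv_mul H hdet])
  rw [invQuad, invQuad, h, Matrix.smul_mulVec, dotProduct_smul, Complex.smul_re, smul_eq_mul]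

/-- With `R = w w^*` and `c = w^* w`, `R² = c R`, so every spectral value is `0` or `c`. -/
theorem vecMulVec_star_le (w : ι → ℂ) :
    Matrix.vecMulVec w (star w) ≤ algebraMap ℝ (Matrix ι ι ℂ) (star w ⬝ᵥ w).re := by
  set R := Matrix.vecMulVec w (star w) with hR
  have hR0 : 0 ≤ R := vecMulVec_star_nonneg w
  have hc : ((star w ⬝ᵥ w).re : ℂ) = star w ⬝ᵥ w :=
    (Complex.eq_re_of_ofReal_le (r := 0) (by simp)).symm
  set c := (star w ⬝ᵥ w).re with hcdef
  have hRR : R * R = c • R := by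
    rw [hR, Matrix.vecMulVec_mul_vecMulVec, ← hc]
    ext i j
    simp [Matrix.vecMulVec_apply]
    ring
  rw [le_algebraMap_iff_spectrum_le (ha := hR0.isSelfAdjoint)]
  intro t ht
  have hpoly : cfc (fun t : ℝ => t ^ 2) R = cfc (fun t : ℝ => c * t) R := by
    rw [cfc_pow_id R 2, sq, hRR]
    exact (cfc_const_mul_id c R hR0.isSelfAdjoint).symm
  have h1 := (cfc_eq_cfc_iff_eqOn (ha := hR0.isSelfAdjoint)).1 hpoly ht
  have ht0 : 0 ≤ t := spectrum_nonneg_of_nonneg hR0 ht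
  have hc0 : 0 ≤ c := by
    have := dotProduct_star_self_nonneg w
    exact (Complex.le_def.1 this).1
  rcases ht0.eq_or_lt with h | h
  · linarith
  · nlinarith

/-- The Cauchy–Schwarz inequality `v v^* ≤ (v^* H⁻¹ v) H`. -/
theorem vecMulVec_star_le_invQuad_smul {H : Matrix ι ι ℂ} (hH : IsStrictlyPositive H)
    (v : ι → ℂ) : Matrix.vecMulVec v (star v) ≤ invQuad H v • H := by
  obtain ⟨C, hC, rfl⟩ := CStarAlgebra.isStrictlyPositive_iff_eq_star_mul_self.1 hH
  have hdet := (Matrix.isUnit_iff_isUnit_det C).1 hC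
  have hCC : C * C⁻¹ = 1 := Matrix.mul_nonsing_inv C hdet
  have hCC' : C⁻¹ * C = 1 := Matrix.nonsing_inv_mul C hdet
  set D := C⁻¹ with hD
  have hstar1 : star D * star C = 1 := by rw [← star_mul, hCC, star_one]
  have hstar2 : star C * star D = 1 := by rw [← star_mul, hCC', star_one]
  have hinv : (star C * C)⁻¹ = D * star D := by
    rw [Matrix.mul_inv_rev, ← hD, ← Matrix.inv_eq_left_inv hstar1]
  set w := star D *ᵥ v with hw
  -- With `v = C^* w` the claim is `w w^* ≤ (w^* w) I` conjugated by `C`.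
  have hv : v = star C *ᵥ w := by rw [hw, Matrix.mulVec_mulVec, hstar2, Matrix.one_mulVec]
  have hww : (star w ⬝ᵥ w).re = invQuad (star C * C) v := by
    rw [invQuad, hinv, hw, Matrix.star_mulVec, ← Matrix.star_eq_conjTranspose, star_star,
      ← Matrix.dotProduct_mulVec, Matrix.mulVec_mulVec]
  have h1 := star_left_conjugate_le_conjugate (vecMulVec_star_le w) C
  rw [hww, Algebra.algebraMap_eq_smul_one, mul_smul_comm, smul_mul_assoc, mul_one,
    Matrix.mul_vecMulVec, Matrix.vecMulVec_mul] at h1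
  have e : star v = star w ᵥ* C := by
    rw [hv, Matrix.star_mulVec, ← Matrix.star_eq_conjTranspose, star_star]
  rwa [← hv, ← e] at h1

theorem continuousAt_invQuad {H : Matrix ι ι ℂ} (hH : IsUnit H) (v : ι → ℂ) :
    ContinuousAt (fun K => invQuad K v) H := by
  have h1 : ContinuousAt (fun K : Matrix ι ι ℂ => K⁻¹) H := by
    simp only [Matrix.nonsing_inv_eq_ringInverse]
    obtain ⟨U, rfl⟩ := hH
    exact NormedRing.inverse_continuousAt U
  have h2 : Continuous fun K : Matrix ι ι ℂ => (star v ⬝ᵥ (K *ᵥ v)).re := by fun_prop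
  exact h2.continuousAt.comp h1

end InverseQuadraticForm

/-! ### Weighted Gram matrices and the reweighting iteration. -/

section WeightedGram

variable {S : Type*} [MeasurableSpace S] {n : ℕ} {ρ : Measure S} {φ : Fin n → S → ℂ} {ε : ℝ}

/-- The rank-one matrix `φ(x) φ(x)^*`. -/
noncomputable def outer (φ : Fin n → S → ℂ) (x : S) : Matrix (Fin n) (Fin n) ℂ :=
  Matrix.vecMulVec (fun i => φ i x) (star fun i => φ i x)

/-- The Gram matrix `∫ s φ φ^* dρ` with respect to the weight `s`. -/
noncomputable def weightedGram (ρ : Measure S) (φ : Fin n → S → ℂ) (s : S → ℝ) :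
    Matrix (Fin n) (Fin n) ℂ :=
  ∫ x, s x • outer φ x ∂ρ

/-- The regularized matrix `M + ε² I`. -/
noncomputable def regularize (ε : ℝ) (M : Matrix (Fin n) (Fin n) ℂ) : Matrix (Fin n) (Fin n) ℂ :=
  M + (ε ^ 2) • (1 : Matrix (Fin n) (Fin n) ℂ)

theorem outer_nonneg (φ : Fin n → S → ℂ) (x : S) : 0 ≤ outer φ x := vecMulVec_star_nonneg _

theorem kWith_eq_invQuad (φ : Fin n → S → ℂ) (ε : ℝ) (M : Matrix (Fin n) (Fin n) ℂ) (x : S) :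
    kWith φ ε M x = invQuad (regularize ε M) fun i => φ i x := by
  have h : ((ε : ℂ) ^ 2) • (1 : Matrix (Fin n) (Fin n) ℂ) = (ε ^ 2) • 1 := by
    rw [← Complex.ofReal_pow]; ext i j; simp
  rw [kWith, invQuad, regularize, h]

theorem isStrictlyPositive_regularize (hε : 0 < ε) {M : Matrix (Fin n) (Fin n) ℂ} (hM : 0 ≤ M) :
    IsStrictlyPositive (regularize ε M) := by
  have h : IsStrictlyPositive ((ε ^ 2) • (1 : Matrix (Fin n) (Fin n) ℂ)) := by
    rw [Matrix.isStrictlyPositive_iff_posDef]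
    exact Matrix.PosDef.one.smul (by positivity)
  exact h.nonneg_add hM

theorem regularize_mono {M K : Matrix (Fin n) (Fin n) ℂ} (h : M ≤ K) :
    regularize ε M ≤ regularize ε K := add_le_add_left h _

theorem le_regularize (M : Matrix (Fin n) (Fin n) ℂ) : M ≤ regularize ε M :=
  le_add_of_nonneg_right (smul_nonneg (by positivity) zero_le_one)

theorem stronglyMeasurable_matrix {A : S → Matrix (Fin n) (Fin n) ℂ}
    (h : ∀ i j, Measurable fun x => A x i j) : StronglyMeasurable A := by
  have e : A = fun x => ∑ i, ∑ j, (A x i j) • Matrix.single i j (1 : ℂ) := by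
    funext x
    conv_lhs => rw [Matrix.matrix_eq_sum_single (A x)]
    simp
  rw [e]
  exact Finset.stronglyMeasurable_fun_sum _ fun i _ => Finset.stronglyMeasurable_fun_sum _
    fun j _ => (h i j).stronglyMeasurable.smul_const _

theorem stronglyMeasurable_outer (hφm : ∀ i, Measurable (φ i)) :
    StronglyMeasurable (outer φ) :=
  stronglyMeasurable_matrix fun i j => by
    simp only [outer, Matrix.vecMulVec_apply, Pi.star_apply]
    exact (hφm i).mul (continuous_star.measurable.comp (hφm j))

theorem integrable_outer (hφ : ∀ i, MemLp (φ i) 2 ρ) : Integrable (outer φ) ρ := by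
  have e : outer φ = fun x => ∑ i, ∑ j, (φ i x * star (φ j x)) • Matrix.single i j (1 : ℂ) := by
    funext x
    conv_lhs => rw [Matrix.matrix_eq_sum_single (outer φ x)]
    simp [outer, Matrix.vecMulVec_apply]
  rw [e]
  exact integrable_finsetSum _ fun i _ => integrable_finsetSum _ fun j _ =>
    ((hφ i).integrable_mul (hφ j).star).smul_const _

theorem integrable_smul_outer (hφ : ∀ i, MemLp (φ i) 2 ρ) {s : S → ℝ} (hs : Measurable s)
    (hs0 : ∀ x, 0 ≤ s x) (hs1 : ∀ x, s x ≤ 1) : Integrable (fun x => s x • outer φ x) ρ :=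
  (integrable_outer hφ).bdd_smul 1 hs.aestronglyMeasurable
    (ae_of_all _ fun x => by rw [Real.norm_of_nonneg (hs0 x)]; exact hs1 x)

theorem gram_eq_weightedGram (hφ : ∀ i, MemLp (φ i) 2 ρ) :
    gram ρ φ = weightedGram ρ φ fun _ => 1 := by
  ext i j
  have h := (entryCLM i j).integral_comp_comm (integrable_outer hφ)
  simp only [entryCLM_apply] at h
  simp only [weightedGram, one_smul]
  rw [← h]
  rfl

theorem weightedGram_nonneg {s : S → ℝ} (hs0 : ∀ x, 0 ≤ s x) : 0 ≤ weightedGram ρ φ s :=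
  integral_nonneg fun x => smul_nonneg (hs0 x) (outer_nonneg φ x)

theorem weightedGram_mono (hφ : ∀ i, MemLp (φ i) 2 ρ) {s t : S → ℝ} (hs : Measurable s)
    (ht : Measurable t) (hs0 : ∀ x, 0 ≤ s x) (hst : ∀ x, s x ≤ t x) (ht1 : ∀ x, t x ≤ 1) :
    weightedGram ρ φ s ≤ weightedGram ρ φ t :=
  integral_mono (integrable_smul_outer hφ hs hs0 fun x => (hst x).trans (ht1 x))
    (integrable_smul_outer hφ ht (fun x => (hs0 x).trans (hst x)) ht1)
    fun x => smul_le_smul_of_nonneg_right (hst x) (outer_nonneg φ x)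

theorem weightedGram_le_gram (hφ : ∀ i, MemLp (φ i) 2 ρ) {s : S → ℝ} (hs : Measurable s)
    (hs0 : ∀ x, 0 ≤ s x) (hs1 : ∀ x, s x ≤ 1) : weightedGram ρ φ s ≤ gram ρ φ := by
  rw [gram_eq_weightedGram hφ]
  exact weightedGram_mono hφ hs measurable_const hs0 hs1 fun _ => le_rfl

theorem gram_nonneg (hφ : ∀ i, MemLp (φ i) 2 ρ) : 0 ≤ gram ρ φ := by
  rw [gram_eq_weightedGram hφ]
  exact weightedGram_nonneg fun _ => zero_le_one

theorem kWith_nonneg (hε : 0 < ε) {M : Matrix (Fin n) (Fin n) ℂ} (hM : 0 ≤ M) (x : S) :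
    0 ≤ kWith φ ε M x := by
  rw [kWith_eq_invQuad]
  exact invQuad_nonneg (isStrictlyPositive_regularize hε hM) _

theorem kWith_anti (hε : 0 < ε) {M K : Matrix (Fin n) (Fin n) ℂ} (hM : 0 ≤ M) (h : M ≤ K)
    (x : S) : kWith φ ε K x ≤ kWith φ ε M x := by
  rw [kWith_eq_invQuad, kWith_eq_invQuad]
  exact invQuad_anti (isStrictlyPositive_regularize hε hM) (regularize_mono h) _

theorem measurable_kWith (hφm : ∀ i, Measurable (φ i)) (M : Matrix (Fin n) (Fin n) ℂ) :
    Measurable (kWith φ ε M) := by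
  rw [funext (kWith_eq_invQuad φ ε M)]
  simp only [invQuad, dotProduct, Matrix.mulVec, Pi.star_apply]
  refine Complex.measurable_re.comp (Finset.measurable_fun_sum _ fun i _ => ?_)
  refine (continuous_star.measurable.comp (hφm i)).mul (Finset.measurable_fun_sum _ fun j _ => ?_)
  exact (hφm j).const_mul _

theorem kFun_le_kWith_weightedGram (hφ : ∀ i, MemLp (φ i) 2 ρ) (hε : 0 < ε) {s : S → ℝ}
    (hs : Measurable s) (hs0 : ∀ x, 0 ≤ s x) (hs1 : ∀ x, s x ≤ 1) (x : S) :
    kFun ρ φ ε x ≤ kWith φ ε (weightedGram ρ φ s) x :=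
  kWith_anti hε (weightedGram_nonneg hs0) (weightedGram_le_gram hφ hs hs0 hs1) x

/-- One step of the iteration that reduces the coherence by reweighting. -/
noncomputable def reweight (ρ : Measure S) (φ : Fin n → S → ℂ) (ε : ℝ) (v : S → ℝ) (s : S → ℝ)
    (x : S) : ℝ :=
  min 1 (v x / kWith φ ε (weightedGram ρ φ s) x)

/-- The update is monotone: a smaller `s` gives a smaller Gram matrix, hence a larger `k_s` and a
smaller new weight. Started at the largest weight `1`, the iteration decreases. -/
theorem reweight_iterate_spec (hφ : ∀ i, MemLp (φ i) 2 ρ) (hφm : ∀ i, Measurable (φ i))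
    (hε : 0 < ε) (hk : ∀ x, 0 < kFun ρ φ ε x) {v : S → ℝ} (hv : Measurable v)
    (hv0 : ∀ x, 0 ≤ v x) (k : ℕ) :
    Measurable ((reweight ρ φ ε v)^[k] fun _ => 1) ∧
    (∀ x, 0 ≤ ((reweight ρ φ ε v)^[k] fun _ => 1) x) ∧
    (∀ x, ((reweight ρ φ ε v)^[k] fun _ => 1) x ≤ 1) ∧
    ∀ x, ((reweight ρ φ ε v)^[k + 1] fun _ => 1) x ≤ ((reweight ρ φ ε v)^[k] fun _ => 1) x := by
  induction k with
  | zero =>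
    exact ⟨measurable_const, fun _ => zero_le_one, fun _ => le_rfl, fun x => min_le_left _ _⟩
  | succ k ih =>
    simp only [Function.iterate_succ_apply'] at ih ⊢
    set s := (reweight ρ φ ε v)^[k] fun _ => 1
    obtain ⟨hm, h0, h1, hle⟩ := ih
    have hpos := fun x => (hk x).trans_le (kFun_le_kWith_weightedGram hφ hε hm h0 h1 x)
    have hm' : Measurable (reweight ρ φ ε v s) :=
      measurable_const.min (hv.div (measurable_kWith hφm _))
    have h0' : ∀ x, 0 ≤ reweight ρ φ ε v s x := fun x =>
      le_min zero_le_one (div_nonneg (hv0 x) (hpos x).le)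
    refine ⟨hm', h0', fun x => min_le_left _ _, fun x => min_le_min le_rfl ?_⟩
    exact div_le_div_of_nonneg_left (hv0 x) (hpos x)
      (kWith_anti hε (weightedGram_nonneg h0') (weightedGram_mono hφ hm' hm h0' hle h1) x)

/-- Coherence-reducing reweighting: the iteration has a fixed point. -/
theorem exists_reweight_fixedPoint (hφ : ∀ i, MemLp (φ i) 2 ρ) (hφm : ∀ i, Measurable (φ i))
    (hε : 0 < ε) (hk : ∀ x, 0 < kFun ρ φ ε x) {v : S → ℝ} (hv : Measurable v)
    (hv0 : ∀ x, 0 ≤ v x) :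
    ∃ s : S → ℝ, Measurable s ∧ (∀ x, 0 ≤ s x) ∧ (∀ x, s x ≤ 1) ∧
      ∀ x, s x = min 1 (v x / kWith φ ε (weightedGram ρ φ s) x) := by
  set t : ℕ → S → ℝ := fun k => (reweight ρ φ ε v)^[k] fun _ => 1 with ht
  have hspec := fun k => reweight_iterate_spec hφ hφm hε hk hv hv0 k
  have hm : ∀ k, Measurable (t k) := fun k => (hspec k).1
  have h0 : ∀ k x, 0 ≤ t k x := fun k => (hspec k).2.1
  have h1 : ∀ k x, t k x ≤ 1 := fun k => (hspec k).2.2.1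
  have hanti : ∀ x, Antitone fun k => t k x := fun x =>
    antitone_nat_of_succ_le fun k => (hspec k).2.2.2 x
  set s : S → ℝ := fun x => ⨅ k, t k x with hs
  have hlim : ∀ x, Tendsto (fun k => t k x) atTop (𝓝 (s x)) := fun x =>
    tendsto_atTop_ciInf (hanti x) ⟨0, by rintro _ ⟨k, rfl⟩; exact h0 k x⟩
  have hsm : Measurable s := measurable_of_tendsto_metrizable hm (tendsto_pi_nhds.2 hlim)
  have hs0 : ∀ x, 0 ≤ s x := fun x => ge_of_tendsto' (hlim x) fun k => h0 k x
  have hs1 : ∀ x, s x ≤ 1 := fun x => le_of_tendsto' (hlim x) fun k => h1 k x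
  refine ⟨s, hsm, hs0, hs1, fun x => ?_⟩
  -- The Gram matrices converge by dominated convergence and inversion is continuous at the
  -- regularized limit, so the update passes to the pointwise limit `s`.
  have hG : Tendsto (fun k => weightedGram ρ φ (t k)) atTop (𝓝 (weightedGram ρ φ s)) := by
    refine tendsto_integral_of_dominated_convergence (fun x => ‖outer φ x‖)
      (fun k => ((hm k).stronglyMeasurable.smul (stronglyMeasurable_outer hφm)).aestronglyMeasurable)
      (integrable_outer hφ).norm (fun k => ae_of_all _ fun y => ?_)
      (ae_of_all _ fun y => (hlim y).smul_const _)
    rw [norm_smul, Real.norm_of_nonneg (h0 k y)]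
    exact mul_le_of_le_one_left (norm_nonneg _) (h1 k y)
  have hkpos : 0 < kWith φ ε (weightedGram ρ φ s) x :=
    (hk x).trans_le (kFun_le_kWith_weightedGram hφ hε hsm hs0 hs1 x)
  have hkt : Tendsto (fun k => kWith φ ε (weightedGram ρ φ (t k)) x) atTop
      (𝓝 (kWith φ ε (weightedGram ρ φ s) x)) := by
    simp only [kWith_eq_invQuad]
    exact (continuousAt_invQuad
      (isStrictlyPositive_regularize hε (weightedGram_nonneg hs0)).isUnit _).tendsto.comp
      (hG.add_const _)
  have hstep : Tendsto (fun k => t (k + 1) x) atTop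
      (𝓝 (min 1 (v x / kWith φ ε (weightedGram ρ φ s) x))) := by
    simp only [ht, Function.iterate_succ_apply']
    exact tendsto_const_nhds.min (tendsto_const_nhds.div hkt hkpos.ne')
  exact tendsto_nhds_unique ((tendsto_add_atTop_iff_nat 1).2 (hlim x)) hstep

end WeightedGram

/-- The preimage of an open set meets each piece in a relatively open subset of a measurable set. -/
theorem PiecewiseLipschitz.measurable {S E : Type*} [PseudoEMetricSpace S] [MeasurableSpace S]
    [OpensMeasurableSpace S] [PseudoEMetricSpace E] [MeasurableSpace E] [BorelSpace E] {f : S → E}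
    (hf : PiecewiseLipschitz f) : Measurable f := by
  obtain ⟨N, piece, hm, -, hU, hL⟩ := hf
  refine measurable_of_isOpen fun U hUo => ?_
  have e : f ⁻¹' U = ⋃ i, (f ⁻¹' U ∩ piece i) := by
    rw [← Set.inter_iUnion, hU, Set.inter_univ]
  rw [e]
  refine MeasurableSet.iUnion fun i => ?_
  obtain ⟨K, hK⟩ := hL i
  obtain ⟨V, hV, hVe⟩ := continuousOn_iff'.1 hK.continuousOn U hUo
  rw [hVe]
  exact hV.measurableSet.inter (hm i)

/-! ### The numerical dimension as a trace. -/

section NumericalDimension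

variable {S : Type*} [MeasurableSpace S] {n : ℕ} {ρ : Measure S} {φ : Fin n → S → ℂ} {ε : ℝ}

/-- From `M (M + ε² I)⁻¹ = I - ε² (M + ε² I)⁻¹`; in this form the monotonicity in `M` is visible. -/
theorem re_trace_mul_inv_regularize (hε : 0 < ε) {M : Matrix (Fin n) (Fin n) ℂ} (hM : 0 ≤ M) :
    (M * (regularize ε M)⁻¹).trace.re = n - ε ^ 2 * ((regularize ε M)⁻¹).trace.re := by
  have hdet := (Matrix.isUnit_iff_isUnit_det _).1 (isStrictlyPositive_regularize hε hM).isUnit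
  have h : M * (regularize ε M)⁻¹ = 1 - (ε ^ 2) • (regularize ε M)⁻¹ := by
    have h1 := Matrix.mul_nonsing_inv _ hdet
    nth_rewrite 1 [regularize] at h1
    rw [add_mul, smul_mul_assoc, one_mul] at h1
    exact eq_sub_of_add_eq h1
  rw [h, Matrix.trace_sub, Matrix.trace_smul, Matrix.trace_one, Complex.sub_re, Complex.smul_re]
  simp

theorem numDim_eq_trace (hφ : ∀ i, MemLp (φ i) 2 ρ) (hε : 0 < ε) :
    numDim ρ φ ε = (gram ρ φ * (regularize ε (gram ρ φ))⁻¹).trace.re := by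
  have hA := gram_isHermitian ρ φ
  have hs := hA.spectral_theorem
  set U : Matrix (Fin n) (Fin n) ℂ := (hA.eigenvectorUnitary : Matrix (Fin n) (Fin n) ℂ) with hU
  have hUU : U * star U = 1 := by simp [hU]
  have hUU' : star U * U = 1 := by simp [hU]
  have hs' : gram ρ φ = U * Matrix.diagonal (fun j => (hA.eigenvalues j : ℂ)) * star U := hs
  have hnn : ∀ i, 0 ≤ hA.eigenvalues i :=
    hA.posSemidef_iff_eigenvalues_nonneg.1 (Matrix.nonneg_iff_posSemidef.1 (gram_nonneg hφ))
  set D := Matrix.diagonal (fun j => (hA.eigenvalues j : ℂ)) with hD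
  set E := Matrix.diagonal (fun j => ((hA.eigenvalues j : ℂ) + (ε : ℂ) ^ 2)⁻¹) with hE
  have hne : ∀ j, (hA.eigenvalues j : ℂ) + (ε : ℂ) ^ 2 ≠ 0 := fun j => by
    have : 0 < hA.eigenvalues j + ε ^ 2 := add_pos_of_nonneg_of_pos (hnn j) (by positivity)
    exact_mod_cast this.ne'
  have hDE : (D + (ε ^ 2) • (1 : Matrix (Fin n) (Fin n) ℂ)) * E = 1 := by
    have h1 : D + (ε ^ 2) • (1 : Matrix (Fin n) (Fin n) ℂ)
        = Matrix.diagonal fun j => (hA.eigenvalues j : ℂ) + (ε : ℂ) ^ 2 := by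
      rw [hD, ← Matrix.diagonal_one, ← Matrix.diagonal_smul, Matrix.diagonal_add]
      congr 1
      funext j
      simp
    rw [h1, hE, Matrix.diagonal_mul_diagonal, ← Matrix.diagonal_one]
    congr 1
    funext j
    exact mul_inv_cancel₀ (hne j)
  have hreg : regularize ε (gram ρ φ)
      = U * (D + (ε ^ 2) • (1 : Matrix (Fin n) (Fin n) ℂ)) * star U := by
    rw [mul_add, add_mul, ← hs', mul_smul_comm, mul_one, smul_mul_assoc, hUU, regularize]
  have hinv : (regularize ε (gram ρ φ))⁻¹ = U * E * star U := by
    refine Matrix.inv_eq_right_inv ?_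
    rw [hreg, show U * (D + (ε ^ 2) • (1 : Matrix (Fin n) (Fin n) ℂ)) * star U * (U * E * star U)
      = U * (D + (ε ^ 2) • (1 : Matrix (Fin n) (Fin n) ℂ)) * (star U * U) * E * star U by
        simp only [mul_assoc], hUU', mul_one, mul_assoc U, hDE, mul_one, hUU]
  have hmul : gram ρ φ * (U * E * star U) = U * (D * E) * star U := by
    calc gram ρ φ * (U * E * star U) = U * D * star U * (U * E * star U) :=
          congrArg (· * (U * E * star U)) hs'
      _ = U * D * (star U * U) * E * star U := by simp only [mul_assoc]
      _ = U * (D * E) * star U := by rw [hUU', mul_one]; simp only [mul_assoc]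
  rw [hinv, hmul, Matrix.trace_mul_comm, ← mul_assoc, hUU', one_mul, hD, hE,
    Matrix.diagonal_mul_diagonal, Matrix.trace_diagonal, Complex.re_sum, numDim]
  refine Finset.sum_congr rfl fun i _ => ?_
  rw [← div_eq_mul_inv, ← Complex.ofReal_pow, ← Complex.ofReal_add, ← Complex.ofReal_div,
    Complex.ofReal_re]

/-- The norm of `G` is itself an eigenvalue, and `λ ≥ ε²` makes its summand at least `1/2`. -/
theorem half_le_numDim [Nonempty (Fin n)] (hφ : ∀ i, MemLp (φ i) 2 ρ) (hε : 0 < ε)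
    (hG : ε ^ 2 ≤ ‖gram ρ φ‖) : 1 / 2 ≤ numDim ρ φ ε := by
  have hA := gram_isHermitian ρ φ
  have hnn : ∀ i, 0 ≤ hA.eigenvalues i :=
    hA.posSemidef_iff_eigenvalues_nonneg.1 (Matrix.nonneg_iff_posSemidef.1 (gram_nonneg hφ))
  have h := CStarAlgebra.norm_mem_spectrum_of_nonneg (gram_nonneg hφ)
  rw [hA.spectrum_real_eq_range_eigenvalues] at h
  obtain ⟨i, hi⟩ := h
  have hε2 : 0 < ε ^ 2 := by positivity
  have hle : 1 / 2 ≤ hA.eigenvalues i / (hA.eigenvalues i + ε ^ 2) := by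
    rw [div_le_div_iff₀ two_pos (by linarith [hnn i])]
    linarith
  refine hle.trans (Finset.single_le_sum (f := fun i => hA.eigenvalues i
    / (hA.eigenvalues i + ε ^ 2)) (fun j _ => ?_) (Finset.mem_univ i))
  exact div_nonneg (hnn j) (by linarith [hnn j])

theorem re_trace_weightedGram_le_numDim (hφ : ∀ i, MemLp (φ i) 2 ρ) (hε : 0 < ε) {s : S → ℝ}
    (hs : Measurable s) (hs0 : ∀ x, 0 ≤ s x) (hs1 : ∀ x, s x ≤ 1) :
    (weightedGram ρ φ s * (regularize ε (weightedGram ρ φ s))⁻¹).trace.re ≤ numDim ρ φ ε := by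
  have h0 : 0 ≤ weightedGram ρ φ s := weightedGram_nonneg hs0
  rw [numDim_eq_trace hφ hε, re_trace_mul_inv_regularize hε h0,
    re_trace_mul_inv_regularize hε (gram_nonneg hφ)]
  have h1 := re_trace_mono (inv_le_inv_of_le (isStrictlyPositive_regularize hε h0)
    (regularize_mono (weightedGram_le_gram hφ hs hs0 hs1)))
  have := mul_le_mul_of_nonneg_left h1 (by positivity : 0 ≤ ε ^ 2)
  linarith

theorem mul_kWith_eq (s : S → ℝ) (M : Matrix (Fin n) (Fin n) ℂ) (x : S) :
    s x * kWith φ ε M x = (s x • outer φ x * (regularize ε M)⁻¹).trace.re := by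
  rw [kWith_eq_invQuad, invQuad_eq_trace, Matrix.trace_mul_comm, smul_mul_assoc,
    Matrix.trace_smul, Complex.smul_re, smul_eq_mul]
  rfl

theorem integrable_mul_kWith (hφ : ∀ i, MemLp (φ i) 2 ρ) {s : S → ℝ} (hs : Measurable s)
    (hs0 : ∀ x, 0 ≤ s x) (hs1 : ∀ x, s x ≤ 1) (M : Matrix (Fin n) (Fin n) ℂ) :
    Integrable (fun x => s x * kWith φ ε M x) ρ := by
  simp only [mul_kWith_eq]
  exact integrable_re_trace_mul (integrable_smul_outer hφ hs hs0 hs1) _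

theorem integral_mul_kWith (hφ : ∀ i, MemLp (φ i) 2 ρ) {s : S → ℝ} (hs : Measurable s)
    (hs0 : ∀ x, 0 ≤ s x) (hs1 : ∀ x, s x ≤ 1) (M : Matrix (Fin n) (Fin n) ℂ) :
    ∫ x, s x * kWith φ ε M x ∂ρ = (weightedGram ρ φ s * (regularize ε M)⁻¹).trace.re := by
  simp only [mul_kWith_eq]
  exact (traceMulCLM (regularize ε M)⁻¹).integral_comp_comm
    (integrable_smul_outer hφ hs hs0 hs1)

end NumericalDimension

/-! ### Christoffel sampling and the empirical Gram matrix. -/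

section Sampling

variable {S : Type*} [MeasurableSpace S] {n : ℕ} {ρ : Measure S} {φ : Fin n → S → ℂ} {ε : ℝ}
  {u : S → ℝ}

theorem integral_abs_eq_of_pos (hu0 : ∀ x, 0 < u x) : ∫ y, |u y| ∂ρ = ∫ y, u y ∂ρ :=
  integral_congr_ae (ae_of_all _ fun y => abs_of_pos (hu0 y))

theorem isProbabilityMeasure_samplingMeasure (hu0 : ∀ x, 0 < u x) (hu : Integrable u ρ)
    (hI : 0 < ∫ y, u y ∂ρ) : IsProbabilityMeasure (samplingMeasure ρ u) := by
  refine ⟨?_⟩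
  rw [samplingMeasure, withDensity_apply _ MeasurableSet.univ, setLIntegral_univ,
    integral_abs_eq_of_pos hu0, ← ofReal_integral_eq_lintegral_ofReal (hu.div_const _)
      (ae_of_all _ fun y => div_nonneg (hu0 y).le hI.le), integral_div, div_self hI.ne',
    ENNReal.ofReal_one]

theorem toReal_ofReal_mul_weight (hu0 : ∀ x, 0 < u x) (hI : 0 < ∫ y, u y ∂ρ) (x : S) (a : ℝ) :
    (ENNReal.ofReal (u x / ∫ y, |u y| ∂ρ)).toReal * (weight ρ u x * a) = a := by
  rw [weight, integral_abs_eq_of_pos hu0, ENNReal.toReal_ofReal (div_nonneg (hu0 x).le hI.le)]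
  have := (hu0 x).ne'
  field_simp

variable {E : Type*} [NormedAddCommGroup E] [NormedSpace ℝ E]

theorem integral_weight_smul_samplingMeasure (hum : Measurable u) (hu0 : ∀ x, 0 < u x)
    (hI : 0 < ∫ y, u y ∂ρ) (a : S → ℝ) (f : S → E) :
    ∫ x, (weight ρ u x * a x) • f x ∂(samplingMeasure ρ u) = ∫ x, a x • f x ∂ρ := by
  rw [samplingMeasure, integral_withDensity_eq_integral_toReal_smul
    (hum.div_const _).ennreal_ofReal (ae_of_all _ fun x => ENNReal.ofReal_lt_top)]
  simp only [smul_smul, toReal_ofReal_mul_weight hu0 hI]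

theorem integrable_weight_smul_samplingMeasure (hum : Measurable u) (hu0 : ∀ x, 0 < u x)
    (hI : 0 < ∫ y, u y ∂ρ) {a : S → ℝ} {f : S → E} (hf : Integrable (fun x => a x • f x) ρ) :
    Integrable (fun x => (weight ρ u x * a x) • f x) (samplingMeasure ρ u) := by
  rw [samplingMeasure, integrable_withDensity_iff_integrable_smul'
    (hum.div_const _).ennreal_ofReal (ae_of_all _ fun x => ENNReal.ofReal_lt_top)]
  simpa only [smul_smul, toReal_ofReal_mul_weight hu0 hI] using hf

theorem measurable_weight (hum : Measurable u) : Measurable (weight ρ u) :=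
  measurable_const.div hum

theorem weight_nonneg (hu0 : ∀ x, 0 < u x) (x : S) : 0 ≤ weight ρ u x :=
  div_nonneg (integral_nonneg fun _ => abs_nonneg _) (hu0 x).le

variable {Ω : Type*} [MeasurableSpace Ω] {P : Measure Ω} [IsProbabilityMeasure P]
  {κ : Type*} [Fintype κ] [Nonempty κ] {x : κ → Ω → S}

/-- Concentration of the empirical weighted Gram matrix under Christoffel sampling. -/
theorem measureReal_empirical_gram_le (hφ : ∀ i, MemLp (φ i) 2 ρ) (hφm : ∀ i, Measurable (φ i))
    (hε : 0 < ε) (hum : Measurable u) (hu0 : ∀ x, 0 < u x) (hu : Integrable u ρ)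
    (hI : 0 < ∫ y, u y ∂ρ) (hx : ∀ k, Measurable (x k)) (hind : iIndepFun x P)
    (hlaw : ∀ k, P.map (x k) = samplingMeasure ρ u)
    {s : S → ℝ} (hs : Measurable s) (hs0 : ∀ y, 0 ≤ s y) (hs1 : ∀ y, s y ≤ 1)
    {c r L : ℝ} (hr : 0 < r) (hκr : Fintype.card κ ≤ r) (hL : 0 < L)
    (hcL : c * (∫ y, u y ∂ρ) / r ≤ L)
    (hcu : ∀ y, s y * kWith φ ε (weightedGram ρ φ s) y ≤ c * u y)
    {Δ : ℝ} (hΔ0 : 0 < Δ) (hΔ1 : Δ < 1) {τ : ℝ} (hτ : τ = Δ ^ 2 / (L * (1 + Δ / 3)))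
    (hτ4 : 4 ≤ τ) {σ : ℝ} (hσ : σ = 1 ∨ σ = -1) :
    P.real {ω | ¬ σ • (∑ k, (weight ρ u (x k ω) * (s (x k ω) / r)) • outer φ (x k ω)
        - (Fintype.card κ / r : ℝ) • weightedGram ρ φ s)
      ≤ Δ • regularize ε (weightedGram ρ φ s)}
      ≤ 2 * numDim ρ φ ε * Real.exp (-(τ / 2)) := by
  have := isProbabilityMeasure_samplingMeasure hu0 hu hI
  set G := weightedGram ρ φ s with hG
  have hG0 : 0 ≤ G := weightedGram_nonneg hs0
  have hH := isStrictlyPositive_regularize hε hG0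
  have hκ : (0 : ℝ) < Fintype.card κ := by exact_mod_cast Fintype.card_pos
  set q : ℝ := Fintype.card κ / r with hq
  have hq0 : 0 ≤ q := by positivity
  have hq1 : q ≤ 1 := (div_le_one hr).2 hκr
  have hqG : q • G ≤ G := by
    simpa using smul_le_smul_of_nonneg_right hq1 hG0
  set Y : S → Matrix (Fin n) (Fin n) ℂ := fun y => (weight ρ u y * (s y / r)) • outer φ y with hY
  have hYm : StronglyMeasurable Y :=
    ((measurable_weight hum).mul (hs.div_const r)).stronglyMeasurable.smul
      (stronglyMeasurable_outer hφm)
  have hcoef : ∀ y, 0 ≤ weight ρ u y * (s y / r) := fun y =>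
    mul_nonneg (weight_nonneg hu0 y) (div_nonneg (hs0 y) hr.le)
  have hY0 : ∀ y, 0 ≤ Y y := fun y => smul_nonneg (hcoef y) (outer_nonneg φ y)
  -- By Cauchy–Schwarz `φ φ^* ≤ k_s H_s`, where `H_s = G_s + ε² I`; then `s k_s ≤ c u`, and the
  -- weight cancels `u`, leaving the constant `c (∫ u) / r`.
  have hYL : ∀ y, Y y ≤ L • regularize ε G := fun y => by
    have h1 : outer φ y ≤ kWith φ ε G y • regularize ε G := by
      rw [kWith_eq_invQuad]; exact vecMulVec_star_le_invQuad_smul hH _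
    refine (smul_le_smul_of_nonneg_left h1 (hcoef y)).trans ?_
    rw [smul_smul]
    refine smul_le_smul_of_nonneg_right ?_ hH.nonneg
    refine le_trans ?_ hcL
    have hw : weight ρ u y * u y = ∫ y, u y ∂ρ := by
      rw [weight, integral_abs_eq_of_pos hu0, div_mul_cancel₀ _ (hu0 y).ne']
    calc weight ρ u y * (s y / r) * kWith φ ε G y
        = weight ρ u y * (s y * kWith φ ε G y) / r := by ring
      _ ≤ weight ρ u y * (c * u y) / r :=
          div_le_div_of_nonneg_right
            (mul_le_mul_of_nonneg_left (hcu y) (weight_nonneg hu0 y)) hr.le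
      _ = c * (∫ y, u y ∂ρ) / r := by rw [← hw]; ring
  have hsi := integrable_smul_outer hφ hs hs0 hs1
  have hsr : (fun y => (s y / r) • outer φ y) = fun y => r⁻¹ • s y • outer φ y := by
    funext y; rw [smul_smul, div_eq_inv_mul]
  have hYi : Integrable Y (samplingMeasure ρ u) :=
    integrable_weight_smul_samplingMeasure hum hu0 hI (by rw [hsr]; exact hsi.smul r⁻¹)
  have hmean : ∫ y, Y y ∂(samplingMeasure ρ u) = (Fintype.card κ : ℝ)⁻¹ • q • G := by
    rw [hY, integral_weight_smul_samplingMeasure hum hu0 hI (fun y => s y / r), hsr,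
      integral_smul, smul_smul, hq]
    congr 1
    field_simp
  have h := measureReal_not_signed_sum_le_smul_le hx hind hlaw hYm hL hH hY0 hYi hYL
    (smul_nonneg hq0 hG0) (hqG.trans (le_regularize G)) hmean hΔ0 hΔ1 hτ hτ4 hσ
  refine h.trans (mul_le_mul_of_nonneg_right ?_ (Real.exp_pos _).le)
  have htr := re_trace_weightedGram_le_numDim hφ hε hs hs0 hs1
  have htr0 : 0 ≤ (G * (regularize ε G)⁻¹).trace.re :=
    re_trace_mul_nonneg hG0 (inv_nonneg_of_isStrictlyPositive hH)
  rw [smul_mul_assoc, Matrix.trace_smul, Complex.smul_re, smul_eq_mul]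
  have := mul_le_of_le_one_left htr0 hq1
  linarith

end Sampling

/-! ### Consequences of the two matrix bounds. -/

section Deterministic

variable {S : Type*} [MeasurableSpace S] {n : ℕ} {ρ : Measure S} {φ : Fin n → S → ℂ} {ε : ℝ}
  {u : S → ℝ} {m M : ℕ} {x : Fin M → S}

theorem sampleMatrix_conjTranspose_mul_self (hu0 : ∀ x, 0 < u x) :
    (sampleMatrix ρ φ u m x)ᴴ * sampleMatrix ρ φ u m x
      = ∑ k, (weight ρ u (x k) * (1 / m)) • outer φ (x k) := by
  ext i j
  rw [Matrix.mul_apply, Matrix.sum_apply]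
  refine Finset.sum_congr rfl fun k _ => ?_
  have h0 : 0 ≤ weight ρ u (x k) / m := div_nonneg (weight_nonneg hu0 _) (Nat.cast_nonneg m)
  have h1 : ((√(weight ρ u (x k) / m) : ℝ) : ℂ) * ((√(weight ρ u (x k) / m) : ℝ) : ℂ)
      = ((weight ρ u (x k) / m : ℝ) : ℂ) := by
    rw [← Complex.ofReal_mul, Real.mul_self_sqrt h0]
  simp only [sampleMatrix, outer, Matrix.conjTranspose_apply, Matrix.of_apply, Matrix.smul_apply,
    Matrix.vecMulVec_apply, Pi.star_apply, star_mul', Complex.star_def, Complex.conj_conj,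
    Complex.conj_ofReal, Complex.real_smul]
  rw [mul_one_div, ← h1]
  ring

theorem sampleMatrix_conjTranspose_mul_self_nonneg :
    0 ≤ (sampleMatrix ρ φ u m x)ᴴ * sampleMatrix ρ φ u m x :=
  Matrix.nonneg_iff_posSemidef.2 (Matrix.posSemidef_conjTranspose_mul_self _)

theorem kFun_le_mul_kWith (hφ : ∀ i, MemLp (φ i) 2 ρ) (hε : 0 < ε) {Δ : ℝ} (hΔ0 : 0 < Δ)
    {K : Matrix (Fin n) (Fin n) ℂ} (hK0 : 0 ≤ K)
    (hK : K ≤ gram ρ φ + Δ • regularize ε (gram ρ φ)) (y : S) :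
    kFun ρ φ ε y ≤ (1 + Δ) * kWith φ ε K y := by
  have hH := isStrictlyPositive_regularize hε (gram_nonneg hφ)
  have hle : regularize ε K ≤ (1 + Δ) • regularize ε (gram ρ φ) := by
    refine (regularize_mono hK).trans_eq ?_
    rw [add_smul, one_smul]
    simp only [regularize]
    abel
  have h := invQuad_anti (isStrictlyPositive_regularize hε hK0) hle fun i => φ i y
  rw [invQuad_smul hH (by positivity)] at h
  rw [kFun, kWith_eq_invQuad, kWith_eq_invQuad]
  rwa [inv_mul_le_iff₀ (by positivity)] at h

theorem kWith_le_inv_mul_kWith (hε : 0 < ε) {α Δ : ℝ} (hα : 0 < α) (hα1 : α ≤ 1) (hΔ1 : Δ < 1)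
    {G K : Matrix (Fin n) (Fin n) ℂ} (hG : 0 ≤ G) (hK : α • (G - Δ • regularize ε G) ≤ K) (y : S) :
    kWith φ ε K y ≤ (α * (1 - Δ))⁻¹ * kWith φ ε G y := by
  have hH := isStrictlyPositive_regularize hε hG
  have hc : 0 < α * (1 - Δ) := mul_pos hα (by linarith)
  -- The hypothesis on `K` leaves a remainder `α ε² I`, which the regularization of `K` absorbs
  -- because `α ≤ 1`.
  have hle : (α * (1 - Δ)) • regularize ε G ≤ regularize ε K := by
    have h1 : (α * (1 - Δ)) • regularize ε G
        = α • (G - Δ • regularize ε G) + (α * ε ^ 2) • (1 : Matrix (Fin n) (Fin n) ℂ) := by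
      rw [mul_smul, sub_smul, one_smul, mul_smul, ← smul_add]
      congr 1
      nth_rewrite 1 [regularize]
      abel
    rw [h1, regularize]
    refine add_le_add hK (smul_le_smul_of_nonneg_right ?_ zero_le_one)
    exact mul_le_of_le_one_left (by positivity) hα1
  have hcH : IsStrictlyPositive ((α * (1 - Δ)) • regularize ε G) := by
    rw [Matrix.isStrictlyPositive_iff_posDef] at hH ⊢
    exact hH.smul hc
  have h := invQuad_anti hcH hle fun i => φ i y
  rwa [invQuad_smul hH hc.ne', ← kWith_eq_invQuad, ← kWith_eq_invQuad] at h

theorem integrable_uNew (hφm : ∀ i, Measurable (φ i)) (hε : 0 < ε) (hum : Measurable u)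
    (hu0 : ∀ x, 0 < u x) (hu : Integrable u ρ) {Δ : ℝ} (hΔ0 : 0 < Δ) :
    Integrable (uNew ρ φ ε u Δ m x) ρ := by
  refine hu.mono' (hum.min ((measurable_kWith hφm _).const_mul _)).aestronglyMeasurable
    (ae_of_all _ fun y => ?_)
  have h0 : 0 ≤ uNew ρ φ ε u Δ m x y := le_min (hu0 y).le (mul_nonneg (by positivity)
    (kWith_nonneg hε sampleMatrix_conjTranspose_mul_self_nonneg y))
  rw [Real.norm_of_nonneg h0]
  exact min_le_left _ _

theorem integral_uNew_le [IsProbabilityMeasure ρ] (hφ : ∀ i, MemLp (φ i) 2 ρ)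
    (hφm : ∀ i, Measurable (φ i)) (hε : 0 < ε)
    (hk : ∀ x, 0 < kFun ρ φ ε x) (hum : Measurable u) (hu0 : ∀ x, 0 < u x) (hu : Integrable u ρ)
    {α Δ : ℝ} (hα : 0 < α) (hα1 : α ≤ 1) (hΔ0 : 0 < Δ) (hΔ1 : Δ < 1) {s : S → ℝ}
    (hs : Measurable s) (hs0 : ∀ x, 0 ≤ s x) (hs1 : ∀ x, s x ≤ 1)
    (hfix : ∀ y, s y = min 1 (α * u y / kWith φ ε (weightedGram ρ φ s) y))
    (hA : α • (weightedGram ρ φ s - Δ • regularize ε (weightedGram ρ φ s))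
      ≤ (sampleMatrix ρ φ u m x)ᴴ * sampleMatrix ρ φ u m x) :
    ∫ y, uNew ρ φ ε u Δ m x y ∂ρ ≤ 2 / (1 - Δ) * (numDim ρ φ ε / α) := by
  set G := weightedGram ρ φ s with hG
  have hΔ' : 0 < 1 - Δ := by linarith
  have hG0 : 0 ≤ G := weightedGram_nonneg hs0
  have hkG : ∀ y, 0 < kWith φ ε G y := fun y =>
    (hk y).trans_le (kFun_le_kWith_weightedGram hφ hε hs hs0 hs1 y)
  set C : ℝ := (1 + Δ) / ((1 - Δ) * α) with hC
  have hC0 : 0 < C := by positivity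
  have hαC : α⁻¹ ≤ C := by
    rw [hC, inv_eq_one_div, div_le_div_iff₀ hα (by positivity)]
    nlinarith
  -- The two branches of the minimum defining `s` select which term of the minimum defining `uNew`
  -- to use.
  have hpt : ∀ y, uNew ρ φ ε u Δ m x y ≤ C * (s y * kWith φ ε G y) := fun y => by
    rcases le_total 1 (α * u y / kWith φ ε G y) with h | h
    · have hsy : s y = 1 := by rw [hfix y, min_eq_left h]
      refine (min_le_right _ _).trans ?_
      have h1 := mul_le_mul_of_nonneg_left
        (kWith_le_inv_mul_kWith (φ := φ) hε hα hα1 hΔ1 hG0 hA y) (by positivity : 0 ≤ 1 + Δ)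
      refine h1.trans_eq ?_
      rw [hsy, hC]
      field_simp
    · have hsy : s y = α * u y / kWith φ ε G y := by rw [hfix y, min_eq_right h]
      refine (min_le_left _ _).trans ?_
      rw [hsy, div_mul_cancel₀ _ (hkG y).ne']
      calc u y = α⁻¹ * (α * u y) := by field_simp
        _ ≤ C * (α * u y) := mul_le_mul_of_nonneg_right hαC (mul_pos hα (hu0 y)).le
  refine (integral_mono (integrable_uNew hφm hε hum hu0 hu hΔ0)
    ((integrable_mul_kWith hφ hs hs0 hs1 G).const_mul C) hpt).trans ?_
  rw [integral_const_mul, integral_mul_kWith hφ hs hs0 hs1]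
  have htr := re_trace_weightedGram_le_numDim hφ hε hs hs0 hs1
  have htr0 : 0 ≤ (G * (regularize ε G)⁻¹).trace.re := re_trace_mul_nonneg hG0
    (inv_nonneg_of_isStrictlyPositive (isStrictlyPositive_regularize hε hG0))
  have hN : 0 ≤ numDim ρ φ ε := htr0.trans htr
  calc C * (G * (regularize ε G)⁻¹).trace.re ≤ C * numDim ρ φ ε :=
        mul_le_mul_of_nonneg_left htr hC0.le
    _ = (1 + Δ) / (1 - Δ) * (numDim ρ φ ε / α) := by rw [hC]; field_simp
    _ ≤ 2 / (1 - Δ) * (numDim ρ φ ε / α) := by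
        refine mul_le_mul_of_nonneg_right ?_ (div_nonneg hN hα.le)
        exact div_le_div_of_nonneg_right (by linarith) hΔ'.le

end Deterministic

/-! ### Constants and assembly. -/

theorem two_mul_mul_exp_neg_le {N γ Δ I m τ : ℝ} (hN : 1 / 2 ≤ N) (hγ0 : 0 < γ) (hγ1 : γ < 1)
    (hΔ0 : 0 < Δ) (hI : 0 < I) (hm0 : 0 < m)
    (hm : (1 + 2 * Δ / 3) / (Δ ^ 2 / 2) * Real.log (16 * N / γ) * I ≤ m)
    (hτ : τ = Δ ^ 2 / (I / m * (1 + Δ / 3))) :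
    4 ≤ τ ∧ 2 * N * Real.exp (-(τ / 2)) ≤ γ := by
  set l := Real.log (16 * N / γ) with hl
  have h8 : 8 ≤ 16 * N / γ := by rw [le_div_iff₀ hγ0]; nlinarith
  -- `exp 2 < 8`; together with `2 l ≤ τ` this supplies the threshold `4 ≤ τ` of the tail bound.
  have hl2 : 2 ≤ l := by
    rw [hl, Real.le_log_iff_exp_le (by linarith)]
    have h1 := Real.exp_one_lt_d9
    have h2 : Real.exp 2 = Real.exp 1 * Real.exp 1 := by rw [← Real.exp_add]; norm_num
    rw [h2]
    nlinarith [Real.exp_pos 1]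
  have hτl : 2 * l ≤ τ := by
    have e : τ = Δ ^ 2 * m / (I * (1 + Δ / 3)) := by rw [hτ]; field_simp
    rw [e, le_div_iff₀ (by positivity)]
    have h1 : (1 + 2 * Δ / 3) * l * I * 2 ≤ Δ ^ 2 * m := by
      have h2 := mul_le_mul_of_nonneg_left hm (by positivity : 0 ≤ Δ ^ 2)
      refine le_trans (le_of_eq ?_) h2
      field_simp
    have h3 : 0 ≤ Δ * (l * I) := by positivity
    nlinarith
  refine ⟨by linarith, ?_⟩
  have h1 : Real.exp (-(τ / 2)) ≤ Real.exp (-l) := Real.exp_le_exp.2 (by linarith)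
  have h2 : Real.exp (-l) = γ / (16 * N) := by
    rw [Real.exp_neg, hl, Real.exp_log (by linarith), inv_div]
  calc 2 * N * Real.exp (-(τ / 2)) ≤ 2 * N * (γ / (16 * N)) := by
        rw [← h2]; exact mul_le_mul_of_nonneg_left h1 (by linarith)
    _ = γ / 8 := by field_simp; ring
    _ ≤ γ := by linarith

/-- The two guarantees of the updated weight function, on a general measurable space. -/
theorem le_measureReal_uNew {S : Type*} [MeasurableSpace S] {n : ℕ} (ρ : Measure S) [IsProbabilityMeasure ρ]
    (φ : Fin n → S → ℂ) (hφ : ∀ i, MemLp (φ i) 2 ρ) (hφm : ∀ i, Measurable (φ i))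
    (ε : ℝ) (hε : 0 < ε) (hk : ∀ x, 0 < kFun ρ φ ε x)
    (hG : ε ^ 2 ≤ ‖gram ρ φ‖)
    (u : S → ℝ) (hu : Integrable u ρ) (hum : Measurable u) (huk : ∀ x, kFun ρ φ ε x ≤ u x)
    (α Δ γ : ℝ) (hα : 0 < α) (hΔ0 : 0 < Δ) (hΔ1 : Δ < 1) (hγ0 : 0 < γ) (hγ1 : γ < 1)
    (m : ℕ)
    (hm : (1 + 2 * Δ / 3) / (Δ ^ 2 / 2) * Real.log (16 * numDim ρ φ ε / γ)
      * (∫ x, u x ∂ρ) ≤ m)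
    {M : ℕ} (hαM : α * m + 1 ≤ M) (hMm' : M < m)
    {Ω : Type*} [MeasurableSpace Ω] (P : Measure Ω) [IsProbabilityMeasure P]
    (x : Fin M → Ω → S)
    (hlaw : ∀ k, HasLaw (x k) (samplingMeasure ρ u) P)
    (hindep : iIndepFun x P) :
    1 - 2 * γ ≤ P.real {ω |
      (∀ y, kFun ρ φ ε y ≤ uNew ρ φ ε u Δ m (fun k => x k ω) y) ∧
      Integrable (uNew ρ φ ε u Δ m (fun k => x k ω)) ρ ∧
      ∫ y, uNew ρ φ ε u Δ m (fun k => x k ω) y ∂ρ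
        ≤ 2 / (1 - Δ) * (numDim ρ φ ε / α)} := by
  have hm0 : (0 : ℝ) < m := by exact_mod_cast (Nat.zero_le _).trans_lt hMm'
  have hMm : (M : ℝ) ≤ m := by exact_mod_cast hMm'.le
  have hM0 : (0 : ℝ) < M := by nlinarith
  have hα1 : α ≤ 1 := by nlinarith
  have : Nonempty (Fin M) := ⟨⟨0, by exact_mod_cast hM0⟩⟩
  obtain ⟨x₀⟩ : Nonempty S := nonempty_of_isProbabilityMeasure ρ
  have : Nonempty (Fin n) := by
    by_contra hne
    have : IsEmpty (Fin n) := not_nonempty_iff.1 hne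
    have := hk x₀
    simp [kFun, kWith, dotProduct] at this
  have hu0 : ∀ x, 0 < u x := fun x => (hk x).trans_le (huk x)
  have hI : 0 < ∫ y, u y ∂ρ := by
    rw [integral_pos_iff_support_of_nonneg (fun y => (hu0 y).le) hu,
      show Function.support u = Set.univ from Set.eq_univ_of_forall fun y => (hu0 y).ne']
    simp
  have hsm := isProbabilityMeasure_samplingMeasure hu0 hu hI
  obtain ⟨s, hs, hs0, hs1, hfix⟩ := exists_reweight_fixedPoint hφ hφm hε hk
    (v := fun y => α * u y) (hum.const_mul α) fun y => (mul_pos hα (hu0 y)).le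
  set τ : ℝ := Δ ^ 2 / ((∫ y, u y ∂ρ) / m * (1 + Δ / 3)) with hτ
  obtain ⟨hτ4, hγ⟩ := two_mul_mul_exp_neg_le (half_le_numDim hφ hε hG) hγ0 hγ1 hΔ0 hI hm0 hm hτ
  have hxm : ∀ k, AEMeasurable (x k) P := fun k => (hlaw k).aemeasurable
  set ν : Measure (Fin M → S) := Measure.pi fun _ => samplingMeasure ρ u with hν
  -- The samples are only almost everywhere measurable, so the concentration bounds are proved for
  -- the coordinates of the product space and pulled back.
  have hmap : P.map (fun ω k => x k ω) = ν := by
    rw [(iIndepFun_iff_map_fun_eq_pi_map hxm).1 hindep, hν]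
    congr 1
    funext k
    exact (hlaw k).map_eq
  have hind : iIndepFun (fun k (z : Fin M → S) => z k) ν :=
    iIndepFun_pi (X := fun _ => id) fun _ => aemeasurable_id
  have hlaw' : ∀ k, ν.map (fun z : Fin M → S => z k) = samplingMeasure ρ u := fun k =>
    (measurePreserving_eval (fun _ : Fin M => samplingMeasure ρ u) k).map_eq
  -- Upper tail: constant weight `1`, normalization `m`. The expected sum is `(M/m) G ≤ G`.
  have hupper := measureReal_empirical_gram_le hφ hφm hε hum hu0 hu hI
    (fun k => measurable_pi_apply k) hind hlaw' (s := fun _ => 1) measurable_const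
    (fun _ => zero_le_one) (fun _ => le_rfl) (c := 1) (r := m) hm0 (by simpa using hMm)
    (div_pos hI hm0) (by rw [one_mul])
    (fun y => by rw [one_mul, one_mul, ← gram_eq_weightedGram hφ]; exact huk y)
    hΔ0 hΔ1 hτ hτ4 (σ := 1) (Or.inl rfl)
  -- Lower tail: weight `s`, normalization `M`. As `α m ≤ M`, the summand bound `α (∫ u) / M` is at
  -- most `(∫ u) / m`, so `τ` is the same for both tails.
  have hlower := measureReal_empirical_gram_le hφ hφm hε hum hu0 hu hI
    (fun k => measurable_pi_apply k) hind hlaw' hs hs0 hs1 (c := α) (r := M) hM0 (by simp)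
    (div_pos hI hm0)
    (by
      rw [div_le_div_iff₀ hM0 hm0]
      nlinarith)
    (fun y => by
      have h1 : s y ≤ α * u y / kWith φ ε (weightedGram ρ φ s) y := by
        rw [hfix y]; exact min_le_right _ _
      rwa [le_div_iff₀ ((hk y).trans_le (kFun_le_kWith_weightedGram hφ hε hs hs0 hs1 y))] at h1)
    hΔ0 hΔ1 hτ hτ4 (σ := -1) (Or.inr rfl)
  rw [← gram_eq_weightedGram hφ] at hupper
  simp only [Fintype.card_fin, one_smul, div_self hM0.ne'] at hupper hlower
  set B₁ : Set (Fin M → S) := {z | ¬ (∑ k, (weight ρ u (z k) * (1 / m)) • outer φ (z k)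
    - (M / m : ℝ) • gram ρ φ) ≤ Δ • regularize ε (gram ρ φ)} with hB₁
  set B₂ : Set (Fin M → S) := {z | ¬ (-1 : ℝ) • (∑ k, (weight ρ u (z k) * (s (z k) / M)) •
    outer φ (z k) - weightedGram ρ φ s) ≤ Δ • regularize ε (weightedGram ρ φ s)} with hB₂
  have hν' : ∀ B : Set (Fin M → S), P.real ((fun ω k => x k ω) ⁻¹' B) ≤ ν.real B := fun B => by
    have h1 := Measure.le_map_apply (μ := P) (aemeasurable_pi_lambda _ hxm) B
    rw [hmap] at h1
    exact ENNReal.toReal_mono (measure_ne_top _ _) h1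
  -- Covering the whole space and using subadditivity avoids having to show that the good event is
  -- measurable.
  have hgood : Set.univ ⊆ {ω |
      (∀ y, kFun ρ φ ε y ≤ uNew ρ φ ε u Δ m (fun k => x k ω) y) ∧
      Integrable (uNew ρ φ ε u Δ m (fun k => x k ω)) ρ ∧
      ∫ y, uNew ρ φ ε u Δ m (fun k => x k ω) y ∂ρ ≤ 2 / (1 - Δ) * (numDim ρ φ ε / α)}
      ∪ (((fun ω k => x k ω) ⁻¹' B₁) ∪ ((fun ω k => x k ω) ⁻¹' B₂)) := by
    intro ω _
    by_cases h1 : (fun k => x k ω) ∈ B₁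
    · exact Or.inr (Or.inl h1)
    by_cases h2 : (fun k => x k ω) ∈ B₂
    · exact Or.inr (Or.inr h2)
    replace h1 := not_not.1 h1
    replace h2 := not_not.1 h2
    have hA0 := sampleMatrix_conjTranspose_mul_self_nonneg (ρ := ρ) (φ := φ) (u := u) (m := m)
      (x := fun k => x k ω)
    have hAeq := sampleMatrix_conjTranspose_mul_self (ρ := ρ) (φ := φ) (m := m)
      (x := fun k => x k ω) hu0
    refine Or.inl ⟨fun y => le_min (huk y) ?_, integrable_uNew hφm hε hum hu0 hu hΔ0, ?_⟩
    · refine kFun_le_mul_kWith hφ hε hΔ0 hA0 ?_ y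
      rw [hAeq]
      have h3 : (M / m : ℝ) • gram ρ φ ≤ gram ρ φ := by
        simpa using smul_le_smul_of_nonneg_right ((div_le_one hm0).2 hMm) (gram_nonneg hφ)
      calc _ ≤ Δ • regularize ε (gram ρ φ) + (M / m : ℝ) • gram ρ φ := sub_le_iff_le_add.1 h1
        _ ≤ Δ • regularize ε (gram ρ φ) + gram ρ φ := add_le_add_right h3 _
        _ = _ := add_comm _ _
    · refine integral_uNew_le hφ hφm hε hk hum hu0 hu hα hα1 hΔ0 hΔ1 hs hs0 hs1 hfix ?_
      rw [neg_smul, one_smul, neg_sub] at h2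
      set E := ∑ k, (weight ρ u (x k ω) * (s (x k ω) / M)) • outer φ (x k ω)
      have hE0 : 0 ≤ E := Finset.sum_nonneg fun k _ => smul_nonneg
        (mul_nonneg (weight_nonneg hu0 _) (div_nonneg (hs0 _) hM0.le)) (outer_nonneg φ _)
      have h3 : weightedGram ρ φ s - Δ • regularize ε (weightedGram ρ φ s) ≤ E :=
        sub_le_comm.1 h2
      refine (smul_le_smul_of_nonneg_left h3 hα.le).trans ?_
      have h4 : α ≤ M / m := by rw [le_div_iff₀ hm0]; linarith
      refine (smul_le_smul_of_nonneg_right h4 hE0).trans ?_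
      rw [hAeq, Finset.smul_sum]
      refine Finset.sum_le_sum fun k _ => ?_
      rw [smul_smul]
      refine smul_le_smul_of_nonneg_right ?_ (outer_nonneg φ _)
      have h5 : (M / m : ℝ) * (weight ρ u (x k ω) * (s (x k ω) / M))
          = weight ρ u (x k ω) * (s (x k ω) / m) := by field_simp
      rw [h5]
      exact mul_le_mul_of_nonneg_left (div_le_div_of_nonneg_right (hs1 _) hm0.le)
        (weight_nonneg hu0 _)
  have h1 := (measureReal_mono (μ := P) hgood).trans
    ((measureReal_union_le _ _).trans (add_le_add_right (measureReal_union_le _ _) _))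
  rw [probReal_univ] at h1
  have h2 := (hν' B₁).trans (hupper.trans hγ)
  have h3 := (hν' B₂).trans (hlower.trans hγ)
  linarith

end Christoffel

theorem theorem4p1 {d n : ℕ} {X : Set (EuclideanSpace ℝ (Fin d))} (hX : IsCompact X)
    (ρ : Measure X) [IsProbabilityMeasure ρ]
    (φ : Fin n → X → ℂ) (hφ : ∀ i, MemLp (φ i) 2 ρ)
    (hφL : ∀ i, Christoffel.PiecewiseLipschitz (φ i))
    (ε : ℝ) (hε : 0 < ε)
    (hk : 0 < ⨅ x : X, Christoffel.kFun ρ φ ε x)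
    (hG : ε ^ 2 ≤ ‖Matrix.toEuclideanCLM (𝕜 := ℂ) (Christoffel.gram ρ φ)‖)
    (u : X → ℝ) (hu : Integrable u ρ) (huL : Christoffel.PiecewiseLipschitz u)
    (huk : ∀ x, Christoffel.kFun ρ φ ε x ≤ u x)
    (α Δ γ : ℝ) (hα : 0 < α) (hΔ0 : 0 < Δ) (hΔ1 : Δ < 1) (hγ0 : 0 < γ) (hγ1 : γ < 1)
    (m : ℕ)
    (hm : (1 + 2 * Δ / 3) / (Δ ^ 2 / 2) * Real.log (16 * Christoffel.numDim ρ φ ε / γ)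
      * (∫ x, u x ∂ρ) ≤ m)
    (hαm : ⌈α * m + 1⌉₊ < m)
    {Ω : Type*} [MeasurableSpace Ω] (P : Measure Ω) [IsProbabilityMeasure P]
    (x : Fin ⌈α * m + 1⌉₊ → Ω → X)
    (hlaw : ∀ k, HasLaw (x k) (Christoffel.samplingMeasure ρ u) P)
    (hindep : iIndepFun x P) :
    1 - 2 * γ ≤ P.real {ω |
      (∀ y, Christoffel.kFun ρ φ ε y ≤ Christoffel.uNew ρ φ ε u Δ m (fun k => x k ω) y) ∧
      Integrable (Christoffel.uNew ρ φ ε u Δ m (fun k => x k ω)) ρ ∧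
      ∫ y, Christoffel.uNew ρ φ ε u Δ m (fun k => x k ω) y ∂ρ
        ≤ 2 / (1 - Δ) * (Christoffel.numDim ρ φ ε / α)} := by
  have hk0 : ∀ y, 0 < Christoffel.kFun ρ φ ε y := fun y => by
    -- The real infimum bounds its values only for a family bounded below; here `0` is a lower
    -- bound.
    refine hk.trans_le (ciInf_le ⟨0, ?_⟩ y)
    rintro _ ⟨z, rfl⟩
    exact Christoffel.kWith_nonneg hε (Christoffel.gram_nonneg hφ) z
  exact Christoffel.le_measureReal_uNew ρ φ hφ (fun i => (hφL i).measurable) ε hε hk0 hG u hu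
    huL.measurable huk α Δ γ hα hΔ0 hΔ1 hγ0 hγ1 m hm (Nat.le_ceil _) hαm P x hlaw hindep
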